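/- Let $(\mathsf T,\otimes,\mathbb 1)$ be a compactly generated tensor triangulated category. That is: $\mathsf T$ is a triangulated category with suspension $\Sigma$ and small coproducts, generated as a localising subcategory by a set of compact objects; $\otimes$ is a symmetric monoidal product on $\mathsf T$ with compact unit $\mathbb 1$ which preserves small coproducts and is exact in each variable, where the natural isomorphisms $\Sigma^m X\otimes Y\cong\Sigma^m(X\otimes Y)$ and $X\otimes\Sigma^n Y\cong\Sigma^n(X\otimes Y)$ are compatible with the associativity, unit and symmetry isomorphisms, and the two resulting isomorphisms $\Sigma^mX\otimes\Sigma^nY\cong\Sigma^{m+n}(X\otimes Y)$ differ by the sign $(-1)^{mn}$. Let $R$ be a $\mathbb Z$-graded, graded commutative ($rs=(-1)^{|r||s|}sr$), noetherian ring, acting canonically on $\mathsf T$: there is given a homomorphism of graded rings $R\to\operatorname{End}^*_{\mathsf T}(\mathbb 1)=\bigoplus_n\operatorname{Hom}_{\mathsf T}(\mathbb 1,\Sigma^n\mathbb 1)$, and $R$ acts on each object $X$ through $R\to\operatorname{End}^*_{\mathsf T}(\mathbb 1)\xrightarrow{-\otimes X}\operatorname{End}^*_{\mathsf T}(X)$,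 hence on $\operatorname{Hom}^*_{\mathsf T}(C,X)=\bigoplus_n\operatorname{Hom}_{\mathsf T}(C,\Sigma^nX)$ for all $C$ and $X$. Let $\operatorname{Spec}R$ be the set of homogeneous prime ideals of $R$. For a specialisation closed subset $\mathcal V\subseteq\operatorname{Spec}R$ let $\mathsf T_{\mathcal V}$ be the full subcategory of those $X$ with $\operatorname{Hom}^*_{\mathsf T}(C,X)_{\mathfrak p}=0$ (homogeneous localisation) for all compact $C$ and all $\mathfrak p\in\operatorname{Spec}R\setminus\mathcal V$, and let $\mathsf T_{\mathcal V}^{\perp}$ be the full subcategory of those $Y$ with $\operatorname{Hom}_{\mathsf T}(X,Y)=0$ for all $X\in\mathsf T_{\mathcal V}$. Then the inclusion $\mathsf T_{\mathcal V}\to\mathsf T$ has a right adjoint and the inclusion $\mathsf T_{\mathcal V}^{\perp}\to\mathsf T$ has a left adjoint. Denote by $\Gamma_{\mathcal V}$ and $L_{\mathcal V}$ these adjoints, regarded as functors $\mathsf T\to\mathsf T$. For $\mathfrak p\in\operatorname{Spec}R$ put $\Gamma_{\mathfrak p}=\Gamma_{\mathcal V(\mathfrak p)}L_{\mathcal Z(\mathfrak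 p)}$, where $\mathcal V(\mathfrak p)=\{\mathfrak q\mid\mathfrak p\subseteq\mathfrak q\}$ and $\mathcal Z(\mathfrak p)=\{\mathfrak q\mid\mathfrak q\not\subseteq\mathfrak p\}$; let $\Gamma_{\mathfrak p}\mathsf T$ be its essential image, and put $\operatorname{supp}_RX=\{\mathfrak p\in\operatorname{Spec}R\mid\Gamma_{\mathfrak p}X\neq0\}$ and $\operatorname{supp}_R\mathsf T=\{\mathfrak p\in\operatorname{Spec}R\mid\Gamma_{\mathfrak p}\mathsf T\neq0\}$. Assume that $\mathsf T$ is stratified by $R$ as a tensor triangulated category: for each $\mathfrak p\in\operatorname{supp}_R\mathsf T$, every non-zero tensor ideal localising subcategory of $\mathsf T$ contained in $\Gamma_{\mathfrak p}\mathsf T$ equals $\Gamma_{\mathfrak p}\mathsf T$. Then for all objects $X,Y$ of $\mathsf T$ $$\operatorname{supp}_R(X\otimes Y)=\operatorname{supp}_RX\cap\operatorname{supp}_RY .$$ -/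

import Mathlib

open CategoryTheory CategoryTheory.Limits MonoidalCategory

universe w v u

namespace TensorSupport

/-! ### Localising subcategories and compact generation -/

section Triangulated

variable {T : Type u} [Category.{v} T] [Preadditive T] [HasZeroObject T] [HasShift T ℤ]
  [∀ n : ℤ, (shiftFunctor T n).Additive] [Pretriangulated T]

/-- A localising subcategory: a full (isomorphism-closed) triangulated subcategory closed under
small coproducts. -/
class IsLocalising (S : ObjectProperty T) : Prop where
  isTriangulated : S.IsTriangulated
  isClosedUnderIsomorphisms : S.IsClosedUnderIsomorphisms
  isClosedUnderCoproducts : ∀ J : Type v, S.IsClosedUnderColimitsOfShape (Discrete J)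

/-- An object `C` is compact if `Hom(C, -)` commutes with small coproducts, that is, if each
morphism from `C` to a small coproduct factors through a finite subcoproduct. -/
def IsCompactObject [HasCoproducts.{v} T] (C : T) : Prop :=
  ∀ (J : Type v) (Y : J → T) (f : C ⟶ ∐ Y), ∃ (s : Finset J)
    (g : C ⟶ ∐ fun j : s => Y j), f = g ≫ Sigma.desc fun j : s => Sigma.ι Y j

variable (T) in
/-- `T` is compactly generated: it is the localising subcategory generated by a set of compact
objects. -/
def IsCompactlyGenerated [HasCoproducts.{v} T] : Prop :=
  ∃ (ι : Type v) (G : ι → T), (∀ i, IsCompactObject (G i)) ∧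
    ∀ S : ObjectProperty T, IsLocalising S → (∀ i, S (G i)) → ∀ X, S X

end Triangulated

/-! ### Tensor triangulated categories -/

section Tensor

variable {T : Type u} [Category.{v} T] [Preadditive T] [HasZeroObject T] [HasShift T ℤ]
  [∀ n : ℤ, (shiftFunctor T n).Additive] [Pretriangulated T]
  [MonoidalCategory T]

section

variable [(curriedTensor T).CommShift₂Int]

/-- The isomorphism `X⟦n⟧ ⊗ Y ≅ (X ⊗ Y)⟦n⟧`. -/
noncomputable def shiftTensorIso (n : ℤ) (X Y : T) : X⟦n⟧ ⊗ Y ≅ (X ⊗ Y)⟦n⟧ :=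
  ((tensorRight Y).commShiftIso n).app X

/-- The isomorphism `X ⊗ Y⟦n⟧ ≅ (X ⊗ Y)⟦n⟧`. -/
noncomputable def tensorShiftIso (n : ℤ) (X Y : T) : X ⊗ Y⟦n⟧ ≅ (X ⊗ Y)⟦n⟧ :=
  ((tensorLeft X).commShiftIso n).app Y

end

variable (T) in
/-- A tensor triangulated category: a triangulated category with small coproducts and a symmetric
monoidal product which is exact in each variable (compatibly with the symmetric monoidal
structure), preserves small coproducts in each variable, and has a compact unit.
The isomorphisms `X⟦m⟧ ⊗ Y ≅ (X ⊗ Y)⟦m⟧` and `X ⊗ Y⟦n⟧ ≅ (X ⊗ Y)⟦n⟧` that are part of the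
exactness are the instance `CommShift₂Int`: they are natural in both variables, and the two ways
from `X⟦m⟧ ⊗ Y⟦n⟧` to `(X ⊗ Y)⟦m + n⟧` differ by the sign `(-1) ^ (m * n)`. -/
class IsTensorTriangulated [IsTriangulated T] [SymmetricCategory T] [HasCoproducts.{v} T]
    [(curriedTensor T).CommShift₂Int] : Prop where
  exact_tensorLeft : ∀ X : T, (tensorLeft X).IsTriangulated
  exact_tensorRight : ∀ X : T, (tensorRight X).IsTriangulated
  coproducts_tensorLeft : ∀ (X : T) (J : Type v),
    PreservesColimitsOfShape (Discrete J) (tensorLeft X)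
  coproducts_tensorRight : ∀ (X : T) (J : Type v),
    PreservesColimitsOfShape (Discrete J) (tensorRight X)
  compact_unit : IsCompactObject (𝟙_ T)
  shift_leftUnitor : ∀ (n : ℤ) (X : T),
    (tensorShiftIso n (𝟙_ T) X).hom ≫ (λ_ X).hom⟦n⟧' = (λ_ (X⟦n⟧)).hom
  shift_rightUnitor : ∀ (n : ℤ) (X : T),
    (shiftTensorIso n X (𝟙_ T)).hom ≫ (ρ_ X).hom⟦n⟧' = (ρ_ (X⟦n⟧)).hom
  shift_associator : ∀ (n : ℤ) (X Y Z : T),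
    (shiftTensorIso n X Y).hom ▷ Z ≫ (shiftTensorIso n (X ⊗ Y) Z).hom ≫ (α_ X Y Z).hom⟦n⟧' =
      (α_ (X⟦n⟧) Y Z).hom ≫ (shiftTensorIso n X (Y ⊗ Z)).hom
  shift_braiding : ∀ (n : ℤ) (X Y : T),
    (shiftTensorIso n X Y).hom ≫ (β_ X Y).hom⟦n⟧' =
      (β_ (X⟦n⟧) Y).hom ≫ (tensorShiftIso n Y X).hom

/-- A full subcategory `S` is tensor ideal if `X ∈ S` and `Y ∈ T` imply `X ⊗ Y ∈ S`. -/
def IsTensorIdeal (S : ObjectProperty T) : Prop :=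
  ∀ X Y : T, S X → S (X ⊗ Y)

end Tensor

/-! ### Graded commutative rings and their homogeneous spectrum -/

section Ring

variable {R : Type w} [Ring R]

/-- `r * s = (-1) ^ (|r| * |s|) * (s * r)` for all homogeneous `r`, `s`. -/
def IsGradedCommutative (𝒜 : ℤ → AddSubgroup R) : Prop :=
  ∀ (i j : ℤ) (r s : R), r ∈ 𝒜 i → s ∈ 𝒜 j → r * s = Int.negOnePow (i * j) • (s * r)

/-- The set `Spec R` of homogeneous prime ideals of a graded ring. (In a graded commutative ring
every homogeneous left ideal is two-sided.) -/
def HomogeneousSpec (𝒜 : ℤ → AddSubgroup R) [GradedRing 𝒜] : Type w :=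
  { p : HomogeneousIdeal 𝒜 // p.toIdeal.IsPrime }

variable {𝒜 : ℤ → AddSubgroup R} [GradedRing 𝒜]

/-- The underlying ideal of a homogeneous prime ideal. -/
def HomogeneousSpec.ideal (p : HomogeneousSpec 𝒜) : Ideal R := p.1.toIdeal

/-- A set of homogeneous primes is specialisation closed if it contains, with `q`, all larger
homogeneous primes. -/
def IsSpecialisationClosed (V : Set (HomogeneousSpec 𝒜)) : Prop :=
  ∀ q p : HomogeneousSpec 𝒜, q ∈ V → q.ideal ≤ p.ideal → p ∈ V

/-- `𝒱(p) = {q | p ⊆ q}`. -/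
def closureOf (p : HomogeneousSpec 𝒜) : Set (HomogeneousSpec 𝒜) := { q | p.ideal ≤ q.ideal }

/-- `𝒵(p) = {q | q ⊈ p}`. -/
def awayFrom (p : HomogeneousSpec 𝒜) : Set (HomogeneousSpec 𝒜) := { q | ¬ q.ideal ≤ p.ideal }

end Ring

/-! ### Canonical actions, local cohomology functors and support -/

section Action

variable {R : Type w} [Ring R] {𝒜 : ℤ → AddSubgroup R} [GradedRing 𝒜]
  {T : Type u} [Category.{v} T] [Preadditive T] [HasZeroObject T] [HasShift T ℤ]
  [∀ n : ℤ, (shiftFunctor T n).Additive] [Pretriangulated T]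
  [MonoidalCategory T] [(curriedTensor T).CommShift₂Int]

variable (𝒜 T) in
/-- The data of a canonical `R`-action on `T`: a homomorphism of graded rings
`R → End^*(𝟙)`, where `End^n(𝟙) = Hom(𝟙, 𝟙⟦n⟧)` and the product of `f` and `g` is
"`f` after `g`". -/
structure CanonicalAction where
  /-- the component in degree `n` -/
  hom (n : ℤ) : 𝒜 n →+ ShiftedHom (𝟙_ T) (𝟙_ T) n
  map_one : hom 0 ⟨1, SetLike.GradedOne.one_mem⟩ = ShiftedHom.mk₀ 0 rfl (𝟙 (𝟙_ T))
  map_mul : ∀ (m n : ℤ) (r : 𝒜 m) (s : 𝒜 n),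
    hom (m + n) ⟨r * s, SetLike.GradedMul.mul_mem r.2 s.2⟩ = (hom n s).comp (hom m r) rfl

namespace CanonicalAction

variable (φ : CanonicalAction 𝒜 T)

/-- The homomorphism `R → End^*(𝟙) → End^*(X)`, the second map being `- ⊗ X`
(with `𝟙 ⊗ X` identified with `X`). -/
noncomputable def act (X : T) {n : ℤ} (r : 𝒜 n) : ShiftedHom X X n :=
  (λ_ X).inv ≫ (φ.hom n r ▷ X) ≫ (shiftTensorIso n (𝟙_ T) X).hom ≫ (λ_ X).hom⟦n⟧'

/-- The action of a homogeneous `r ∈ R` on `Hom^*(C, X) = ⨁ₘ Hom(C, X⟦m⟧)`. -/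
noncomputable def smul {C X : T} {n m : ℤ} (r : 𝒜 n) (f : ShiftedHom C X m) :
    ShiftedHom C X (n + m) :=
  f.comp (φ.act X r) rfl

/-- The homogeneous localisation `Hom^*(C, X)_p` vanishes: each homogeneous element of
`Hom^*(C, X)` is annihilated by a homogeneous element of `R` outside `p`. -/
def HomLocalisationIsZero (C X : T) (p : HomogeneousSpec 𝒜) : Prop :=
  ∀ (m : ℤ) (f : ShiftedHom C X m), ∃ (n : ℤ) (s : 𝒜 n), (s : R) ∉ p.ideal ∧ φ.smul s f = 0

variable [HasCoproducts.{v} T]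

/-- The full subcategory `T_V` of `V`-torsion objects: those `X` with `Hom^*(C, X)_p = 0` for all
compact `C` and all `p ∉ V`. -/
def torsion (V : Set (HomogeneousSpec 𝒜)) : ObjectProperty T := fun X =>
  ∀ C : T, IsCompactObject C → ∀ p : HomogeneousSpec 𝒜, p ∉ V → φ.HomLocalisationIsZero C X p

/-- The full subcategory of `V`-local objects, the right orthogonal of `T_V`. -/
def localObjects (V : Set (HomogeneousSpec 𝒜)) : ObjectProperty T := (φ.torsion V).rightOrthogonal

open Classical in
/-- The local cohomology functor `Γ_V : T ⥤ T`: the right adjoint of the inclusion of `T_V`,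
followed by the inclusion. (The identity functor is a placeholder for the case in which there is
no adjoint.) -/
noncomputable def localCohomology (V : Set (HomogeneousSpec 𝒜)) : T ⥤ T :=
  if _h : (φ.torsion V).ι.IsLeftAdjoint then (φ.torsion V).ι.rightAdjoint ⋙ (φ.torsion V).ι
  else 𝟭 T

open Classical in
/-- The localisation functor `L_V : T ⥤ T` with kernel `T_V`: the left adjoint of the inclusion
of the `V`-local objects, followed by the inclusion. (The identity functor is a placeholder for
the case in which there is no adjoint.) -/
noncomputable def localisation (V : Set (HomogeneousSpec 𝒜)) : T ⥤ T :=
  if _h : (φ.localObjects V).ι.IsRightAdjoint then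
    (φ.localObjects V).ι.leftAdjoint ⋙ (φ.localObjects V).ι
  else 𝟭 T

/-- `Γ_p X = Γ_{𝒱(p)} (X_p)` with `X_p = L_{𝒵(p)} X`. -/
noncomputable def localCohomologyAt (p : HomogeneousSpec 𝒜) : T ⥤ T :=
  φ.localisation (awayFrom p) ⋙ φ.localCohomology (closureOf p)

/-- `supp_R X = {p | Γ_p X ≠ 0}`. -/
def supp (X : T) : Set (HomogeneousSpec 𝒜) :=
  { p | ¬ IsZero ((φ.localCohomologyAt p).obj X) }

/-- `supp_R T = {p | Γ_p T ≠ 0}`, where `Γ_p T` is the essential image of `Γ_p`. -/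
def suppCategory : Set (HomogeneousSpec 𝒜) :=
  { p | ∃ X : T, (φ.localCohomologyAt p).essImage X ∧ ¬ IsZero X }

/-- `T` is stratified by `R` as a tensor triangulated category: for each `p ∈ supp_R T`, the
subcategory `Γ_p T` is minimal, i.e. each non-zero tensor ideal localising subcategory contained
in `Γ_p T` is all of `Γ_p T`. -/
def IsStratified : Prop :=
  ∀ p ∈ φ.suppCategory, ∀ S : ObjectProperty T, IsLocalising S → IsTensorIdeal S →
    S ≤ (φ.localCohomologyAt p).essImage → (∃ X, S X ∧ ¬ IsZero X) →
    S = (φ.localCohomologyAt p).essImage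

end CanonicalAction

end Action

end TensorSupport

/-! The core is that `Γ_p` is tensoring with an object. Given this, suppose `Γ_p (X ⊗ Y) = 0` and
`Γ_p X ≠ 0`. The objects of `Γ_p T` annihilated by `- ⊗ Y` form a localising tensor ideal containing
`Γ_p X`, so by minimality they are all of `Γ_p T`. In particular `Γ_p 𝟙` is annihilated, that is,
`Γ_p Y = 0`. The other inclusion is immediate.

For the core, tensor the localisation triangle of `𝟙` with `X`. The result is a localisation
triangle of `X` once torsion and local objects are both tensor ideals (`isTensorIdeal_torsion`,
`isTensorIdeal_localObjects`). Both facts come from Koszul objects `K`, iterated cones of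
homogeneous elements whose common homogeneous primes all lie in `V`: the `K ⊗ W` generate the
torsion objects (`torsion_le`, from the noetherian argument in `isZero_of_torsion`), and `Y` is
local iff `K ⊗ Y = 0` for all such `K` (`localObjects_iff`).

Compact objects are not assumed rigid, so the last equivalence cannot use duals. It rests on
`isZero_koszulSeq_tensor_iff`, where the nilpotence of an element on its own cone plays the part of
self-duality. Existence of the adjoints is Bousfield localisation at the compact objects `K ⊗ G`,
with `G` a compact generator (`exists_trW_orthogonal`). -/

namespace TensorSupport

/-! ### Exactness in triangles, and compact objects -/

section Triangulated

open Pretriangulated ZeroObject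

section Exactness

variable {T : Type u} [Category.{v} T] [Preadditive T] [HasZeroObject T] [HasShift T ℤ]
  [∀ n : ℤ, (shiftFunctor T n).Additive] [Pretriangulated T]
  {X Y Z W : T} {f : X ⟶ Y} {g : Y ⟶ Z} {h : Z ⟶ X⟦(1 : ℤ)⟧}

lemma dist_comp₁₂ (hT : Triangle.mk f g h ∈ distTriang T) : f ≫ g = 0 := comp_distTriang_mor_zero₁₂ _ hT

lemma dist_comp₃₁ (hT : Triangle.mk f g h ∈ distTriang T) : h ≫ f⟦(1 : ℤ)⟧' = 0 := comp_distTriang_mor_zero₃₁ _ hT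

lemma dist_lift₁ (hT : Triangle.mk f g h ∈ distTriang T) (k : W ⟶ X⟦(1 : ℤ)⟧) (hk : k ≫ f⟦(1 : ℤ)⟧' = 0) : ∃ l : W ⟶ Z, k = l ≫ h :=
  Triangle.coyoneda_exact₁ _ hT k hk

lemma dist_lift₂ (hT : Triangle.mk f g h ∈ distTriang T) (k : W ⟶ Y) (hk : k ≫ g = 0) : ∃ l : W ⟶ X, k = l ≫ f :=
  Triangle.coyoneda_exact₂ _ hT k hk

lemma dist_lift₃ (hT : Triangle.mk f g h ∈ distTriang T) (k : W ⟶ Z) (hk : k ≫ h = 0) : ∃ l : W ⟶ Y, k = l ≫ g :=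
  Triangle.coyoneda_exact₃ _ hT k hk

lemma dist_desc₂ (hT : Triangle.mk f g h ∈ distTriang T) (k : Y ⟶ W) (hk : f ≫ k = 0) : ∃ l : Z ⟶ W, k = g ≫ l :=
  Triangle.yoneda_exact₂ _ hT k hk

lemma dist_desc₃ (hT : Triangle.mk f g h ∈ distTriang T) (k : Z ⟶ W) (hk : g ≫ k = 0) : ∃ l : X⟦(1 : ℤ)⟧ ⟶ W, k = h ≫ l :=
  Triangle.yoneda_exact₃ _ hT k hk

/-- Shifting the source back by `n`, instead of shifting the triangle, avoids signs in the
connecting morphism. -/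
lemma dist_shift_lift₂ (hT : Triangle.mk f g h ∈ distTriang T) {n : ℤ} (k : W ⟶ Y⟦n⟧)
    (hk : k ≫ g⟦n⟧' = 0) : ∃ l : W ⟶ X⟦n⟧, k = l ≫ f⟦n⟧' := by
  obtain ⟨k', hk'⟩ := (shiftFunctor T n).map_surjective ((shiftNegShift W n).hom ≫ k)
  obtain ⟨l, rfl⟩ := dist_lift₂ hT k' ((shiftFunctor T n).map_injective (by
    rw [Functor.map_comp, hk', Category.assoc, hk, comp_zero, Functor.map_zero]))
  refine ⟨(shiftNegShift W n).inv ≫ l⟦n⟧', ?_⟩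
  rw [Category.assoc, ← Functor.map_comp, hk', Iso.inv_hom_id_assoc]

lemma dist_shift_lift₃ (hT : Triangle.mk f g h ∈ distTriang T) {n : ℤ} (k : W ⟶ Z⟦n⟧)
    (hk : k ≫ h⟦n⟧' = 0) : ∃ l : W ⟶ Y⟦n⟧, k = l ≫ g⟦n⟧' := by
  obtain ⟨k', hk'⟩ := (shiftFunctor T n).map_surjective ((shiftNegShift W n).hom ≫ k)
  obtain ⟨l, rfl⟩ := dist_lift₃ hT k' ((shiftFunctor T n).map_injective (by
    rw [Functor.map_comp, hk', Category.assoc, hk, comp_zero, Functor.map_zero]))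
  refine ⟨(shiftNegShift W n).inv ≫ l⟦n⟧', ?_⟩
  rw [Category.assoc, ← Functor.map_comp, hk', Iso.inv_hom_id_assoc]

end Exactness

variable {T : Type u} [Category.{v} T] [Preadditive T] [HasZeroObject T] [HasShift T ℤ]
  [∀ n : ℤ, (shiftFunctor T n).Additive] [Pretriangulated T] [HasCoproducts.{v} T]

/-- The projection of a coproduct onto the subcoproduct indexed by a finite set, viewed as an
idempotent endomorphism of the coproduct. -/
noncomputable def coproductRestrict {J : Type v} (Y : J → T) (s : Finset J) : ∐ Y ⟶ ∐ Y :=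
  open Classical in ∑ j ∈ s, Sigma.π Y j ≫ Sigma.ι Y j

open Classical in
lemma ι_coproductRestrict {J : Type v} (Y : J → T) (s : Finset J) (j : J) :
    Sigma.ι Y j ≫ coproductRestrict Y s = if j ∈ s then Sigma.ι Y j else 0 := by
  rw [coproductRestrict, Preadditive.comp_sum]
  split_ifs with h
  · rw [Finset.sum_eq_single_of_mem j h]
    · rw [Sigma.ι_π_eq_id_assoc]
    · intro b _ hb
      rw [Sigma.ι_π_of_ne_assoc _ hb.symm, zero_comp]
  · refine Finset.sum_eq_zero fun b hb => ?_
    rw [Sigma.ι_π_of_ne_assoc _ (by rintro rfl; exact h hb), zero_comp]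

lemma coproductRestrict_comp {J : Type v} (Y : J → T) {s t : Finset J} (h : s ⊆ t) :
    coproductRestrict Y s ≫ coproductRestrict Y t = coproductRestrict Y s := by
  classical
  refine Limits.Sigma.hom_ext _ _ fun j => ?_
  rw [← Category.assoc, ι_coproductRestrict]
  split_ifs with hj
  · rw [ι_coproductRestrict, if_pos (h hj)]
  · rw [zero_comp]

lemma comp_coproductRestrict_of_subset {J : Type v} {Y : J → T} {s t : Finset J} (h : s ⊆ t)
    {C : T} {f : C ⟶ ∐ Y} (hf : f ≫ coproductRestrict Y s = f) :
    f ≫ coproductRestrict Y t = f := by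
  rw [← hf, Category.assoc, coproductRestrict_comp Y h]

/-- Being fixed by an idempotent is an equation, which is easier to transport along shifts and
triangles than a factorisation. -/
lemma isCompactObject_iff (C : T) : IsCompactObject C ↔
    ∀ (J : Type v) (Y : J → T) (f : C ⟶ ∐ Y), ∃ s : Finset J, f ≫ coproductRestrict Y s = f := by
  classical
  refine ⟨fun h J Y f => ?_, fun h J Y f => ?_⟩
  · obtain ⟨s, g, rfl⟩ := h J Y f
    refine ⟨s, ?_⟩
    rw [Category.assoc]
    congr 1
    refine Limits.Sigma.hom_ext _ _ fun j => ?_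
    rw [Sigma.ι_desc_assoc, Sigma.ι_desc, ι_coproductRestrict, if_pos j.2]
  · obtain ⟨s, hs⟩ := h J Y f
    refine ⟨s, f ≫ Sigma.desc (fun j => if hj : j ∈ s then
      Sigma.ι (fun j : s => Y j) ⟨j, hj⟩ else 0), ?_⟩
    conv_lhs => rw [← hs]
    rw [Category.assoc]
    congr 1
    refine Limits.Sigma.hom_ext _ _ fun j => ?_
    rw [ι_coproductRestrict, Sigma.ι_desc_assoc]
    split_ifs
    · rw [Sigma.ι_desc]
    · rw [zero_comp]


lemma IsCompactObject.of_retract {C D : T} (hD : IsCompactObject D) (i : C ⟶ D) (r : D ⟶ C)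
    (h : i ≫ r = 𝟙 C) : IsCompactObject C := by
  rw [isCompactObject_iff] at hD ⊢
  intro J Y f
  obtain ⟨s, hs⟩ := hD J Y (r ≫ f)
  refine ⟨s, ?_⟩
  have := i ≫= hs
  simpa only [Category.assoc, reassoc_of% h] using this

lemma IsCompactObject.of_iso {C D : T} (hD : IsCompactObject D) (e : C ≅ D) :
    IsCompactObject C :=
  hD.of_retract e.hom e.inv e.hom_inv_id

lemma sigmaComparison_shift_coproductRestrict {J : Type v} (Y : J → T) (s : Finset J) (n : ℤ) :
    sigmaComparison (shiftFunctor T n) Y ≫ (coproductRestrict Y s)⟦n⟧' =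
      coproductRestrict (fun j => Y j⟦n⟧) s ≫ sigmaComparison (shiftFunctor T n) Y := by
  classical
  refine Limits.Sigma.hom_ext _ _ fun j => ?_
  rw [ι_comp_sigmaComparison_assoc, ← Functor.map_comp, ι_coproductRestrict,
    ← Category.assoc, ι_coproductRestrict]
  split_ifs
  · rw [ι_comp_sigmaComparison]
  · rw [Functor.map_zero, zero_comp]

lemma IsCompactObject.shift {C : T} (hC : IsCompactObject C) (n : ℤ) :
    IsCompactObject (C⟦n⟧) := by
  rw [isCompactObject_iff] at hC ⊢
  intro J Y f
  obtain ⟨s, hs⟩ := hC J (fun j => Y j⟦-n⟧) ((shiftShiftNeg C n).inv ≫ f⟦-n⟧' ≫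
    inv (sigmaComparison (shiftFunctor T (-n)) Y))
  refine ⟨s, (shiftFunctor T (-n)).map_injective ?_⟩
  have h := hs =≫ sigmaComparison (shiftFunctor T (-n)) Y
  simp only [Category.assoc, ← sigmaComparison_shift_coproductRestrict, IsIso.inv_hom_id,
    IsIso.inv_hom_id_assoc, Category.comp_id, Iso.cancel_iso_inv_left] at h
  rw [Functor.map_comp, h]

/-- Correcting `f` by its part on a finite `s` makes it vanish on the first vertex. The rest factors
through the third vertex and involves only a finite `t`, so `s ∪ t` suffices for `f`. -/
lemma IsCompactObject.ext₂ {A : Triangle T} (hA : A ∈ distTriang T)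
    (h₁ : IsCompactObject A.obj₁) (h₃ : IsCompactObject A.obj₃) : IsCompactObject A.obj₂ := by
  classical
  rw [isCompactObject_iff] at h₁ h₃ ⊢
  intro J Y f
  obtain ⟨s, hs⟩ := h₁ J Y (A.mor₁ ≫ f)
  obtain ⟨k, hk⟩ := Triangle.yoneda_exact₂ _ hA (f - f ≫ coproductRestrict Y s) (by
    rw [Preadditive.comp_sub, ← Category.assoc, hs, sub_self])
  obtain ⟨t, ht⟩ := h₃ J Y k
  refine ⟨s ∪ t, ?_⟩
  have h : (f - f ≫ coproductRestrict Y s) ≫ coproductRestrict Y (s ∪ t) =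
      f - f ≫ coproductRestrict Y s := by
    rw [hk, Category.assoc, comp_coproductRestrict_of_subset Finset.subset_union_right ht]
  rw [Preadditive.sub_comp, Category.assoc,
    coproductRestrict_comp Y Finset.subset_union_left] at h
  exact sub_left_injective h

lemma isCompactObject_of_isZero {C : T} (hC : IsZero C) : IsCompactObject C := by
  rw [isCompactObject_iff]
  exact fun J Y f => ⟨∅, hC.eq_of_src _ _⟩

variable (T) in
/-- The full subcategory of compact objects. -/
def compactObjects : ObjectProperty T := IsCompactObject

instance : (compactObjects T).IsClosedUnderIsomorphisms where
  of_iso e h := IsCompactObject.of_iso h e.symm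

instance : (compactObjects T).IsTriangulated where
  exists_zero := ⟨0, isZero_zero _, isCompactObject_of_isZero (isZero_zero _)⟩
  isStableUnderShiftBy n := ⟨fun _ h => IsCompactObject.shift h n⟩
  toIsTriangulatedClosed₂ := .mk' fun _ hA h₁ h₃ => IsCompactObject.ext₂ hA h₁ h₃

lemma IsCompactObject.comp_eq_zero {C : T} (hC : IsCompactObject C) {J : Type v} {Y : J → T}
    {Z : T} (k : ∐ Y ⟶ Z) (h : ∀ (j : J) (g : C ⟶ Y j), g ≫ Sigma.ι Y j ≫ k = 0)
    (f : C ⟶ ∐ Y) : f ≫ k = 0 := by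
  classical
  rw [isCompactObject_iff] at hC
  obtain ⟨s, hs⟩ := hC J Y f
  rw [← hs, coproductRestrict, Preadditive.comp_sum, Preadditive.sum_comp]
  exact Finset.sum_eq_zero fun j _ => by
    simpa only [Category.assoc] using h j (f ≫ Sigma.π Y j)

end Triangulated

/-! ### Homotopy colimits and Bousfield localisation at compact objects -/

section Localisation

open Pretriangulated ZeroObject Opposite

variable {T : Type u} [Category.{v} T] [Preadditive T] [HasZeroObject T] [HasShift T ℤ]
  [∀ n : ℤ, (shiftFunctor T n).Additive] [Pretriangulated T] [HasCoproducts.{v} T]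

attribute [instance] IsLocalising.isTriangulated IsLocalising.isClosedUnderIsomorphisms
  IsLocalising.isClosedUnderCoproducts

lemma IsLocalising.coproduct {S : ObjectProperty T} [IsLocalising S] {J : Type v} {Y : J → T}
    (h : ∀ j, S (Y j)) : S (∐ Y) :=
  S.prop_colimit _ fun j => h j.as

lemma IsLocalising.of_coproduct {S : ObjectProperty T} [S.IsTriangulated]
    [S.IsClosedUnderIsomorphisms] (h : ∀ (J : Type v) (Y : J → T), (∀ j, S (Y j)) → S (∐ Y)) :
    IsLocalising S where
  isTriangulated := inferInstance
  isClosedUnderIsomorphisms := inferInstance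
  isClosedUnderCoproducts J := by
    refine ⟨?_⟩
    rintro X ⟨p⟩
    exact S.prop_of_iso (p.isColimit.coconePointUniqueUpToIso (coproductIsCoproduct' _)).symm
      (h J _ fun j => p.prop_diag_obj ⟨j⟩)

instance (S S' : ObjectProperty T) [IsLocalising S] [IsLocalising S'] : IsLocalising (S ⊓ S') :=
  .of_coproduct fun _ _ h =>
    ⟨IsLocalising.coproduct fun j => (h j).1, IsLocalising.coproduct fun j => (h j).2⟩

/-- A coproduct of morphisms with cones in a localising subcategory has its cone in it. -/
lemma trW_sigmaMap {S : ObjectProperty T} [IsLocalising S] {J : Type v} {X Y : J → T}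
    (f : ∀ j, X j ⟶ Y j) (hf : ∀ j, S.trW (f j)) : S.trW (Limits.Sigma.map f) := by
  -- Pass to the opposite category: the coproduct becomes a product, and products of distinguished
  -- triangles are distinguished.
  have : S.op.IsClosedUnderLimitsOfShape (Discrete J) := by
    rw [← ObjectProperty.isClosedUnderColimitsOfShape_op_iff_op,
      ObjectProperty.isClosedUnderColimitsOfShape_iff,
      ← ObjectProperty.colimitsOfShape_congr _ (Discrete.opposite J).symm]
    exact ObjectProperty.colimitsOfShape_le _ _
  have hf' : ∀ j, S.op.trW (f j).op := fun j => by
    rw [ObjectProperty.trW_op]; exact hf j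
  choose Z g h hT hZ using hf'
  have key : S.op.trW (Limits.Pi.map fun j => (f j).op) :=
    ObjectProperty.trW.mk _ (productTriangle_distinguished _ hT) (S.op.prop_pi _ hZ)
  have : S.op.trW (Limits.Sigma.map f).op := by
    refine (S.op.trW.arrow_mk_iso_iff (Arrow.isoMk (opCoproductIsoProduct Y)
      (opCoproductIsoProduct X) ?_)).2 key
    refine Limits.Pi.hom_ext _ _ fun j => ?_
    simp [opCoproductIsoProduct_hom_comp_π, ← op_comp]
  rwa [ObjectProperty.trW_op] at this

section Telescope

variable (A : ℕ → T) (a : ∀ n, A n ⟶ A (n + 1))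

/-- The coproduct of the terms of a sequence. -/
noncomputable abbrev seqCoproduct : T := ∐ fun i : ULift.{v} ℕ => A i.down

/-- The inclusion of a term of a sequence in the coproduct of all terms. -/
noncomputable abbrev seqι (n : ℕ) : A n ⟶ seqCoproduct A :=
  Sigma.ι (fun i : ULift.{v} ℕ => A i.down) ⟨n⟩

variable {A} in
/-- The morphism out of the coproduct of the terms of a sequence with given components. -/
noncomputable def seqDesc {Z : T} (f : ∀ n, A n ⟶ Z) : seqCoproduct A ⟶ Z :=
  Sigma.desc fun i => f i.down

variable {A} in
@[simp]
lemma seqι_desc {Z : T} (f : ∀ n, A n ⟶ Z) (n : ℕ) : seqι A n ≫ seqDesc f = f n :=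
  Sigma.ι_desc _ _

variable {A} in
@[simp]
lemma seqι_desc_assoc {Z W : T} (f : ∀ n, A n ⟶ Z) (n : ℕ) (g : Z ⟶ W) :
    seqι A n ≫ seqDesc f ≫ g = f n ≫ g :=
  Sigma.ι_desc_assoc _ _ _

variable {A} in
lemma seqCoproduct_hom_ext {Z : T} {f g : seqCoproduct A ⟶ Z}
    (h : ∀ n, seqι A n ≫ f = seqι A n ≫ g) : f = g :=
  Limits.Sigma.hom_ext _ _ fun i => h i.down

/-- The endomorphism of the coproduct of a sequence induced by the transition morphisms. -/
noncomputable def seqShift : seqCoproduct A ⟶ seqCoproduct A :=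
  seqDesc fun n => a n ≫ seqι A (n + 1)

@[simp]
lemma seqι_shift (n : ℕ) : seqι A n ≫ seqShift A a = a n ≫ seqι A (n + 1) :=
  seqι_desc _ _

@[simp]
lemma seqι_shift_assoc (n : ℕ) {W : T} (g : seqCoproduct A ⟶ W) :
    seqι A n ≫ seqShift A a ≫ g = a n ≫ seqι A (n + 1) ≫ g := by
  rw [seqShift, seqι_desc_assoc, Category.assoc]

/-- For a constant sequence `1 - shift` is a split monomorphism, so the telescope triangle splits
and the fold map induces the inverse. -/
lemma isIso_seqι_zero_of_const (X : T) {H : T} {p : seqCoproduct (fun _ => X) ⟶ H}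
    {d : H ⟶ (seqCoproduct fun _ => X)⟦(1 : ℤ)⟧}
    (hT : Triangle.mk (𝟙 _ - seqShift (fun _ => X) (fun _ => 𝟙 X)) p d ∈ distTriang T) :
    IsIso (seqι (fun _ => X) 0 ≫ p) := by
  let ι := seqι (fun _ : ℕ => X)
  -- The partial sums telescope: the components satisfy `r_n - r_(n+1) = ι n`.
  let r : seqCoproduct (fun _ => X) ⟶ seqCoproduct (fun _ => X) :=
    seqDesc fun n => - ∑ k ∈ Finset.range n, ι k
  have hr : (𝟙 _ - seqShift (fun _ => X) (fun _ => 𝟙 X)) ≫ r = 𝟙 _ := by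
    refine seqCoproduct_hom_ext fun n => ?_
    simp [r, ι, Preadditive.sub_comp, Preadditive.comp_sub, Finset.sum_range_succ]
  have hd : d = 0 := by
    have h := dist_comp₃₁ hT =≫ r⟦(1 : ℤ)⟧'
    rwa [Category.assoc, ← Functor.map_comp, hr, CategoryTheory.Functor.map_id, Category.comp_id, zero_comp] at h
  have : Epi p := (Triangle.epi₂ _ hT hd :)
  have hp : ∀ n, ι n ≫ p = ι 0 ≫ p := by
    intro n
    induction n with
    | zero => rfl
    | succ n hn =>
      rw [← hn]
      have h := ι n ≫= dist_comp₁₂ hT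
      simp only [ι, Preadditive.sub_comp, Category.id_comp, Preadditive.comp_sub, seqι_shift_assoc,
        comp_zero, sub_eq_zero] at h
      exact h.symm
  obtain ⟨q, hq⟩ := dist_desc₂ hT
    (seqDesc fun _ => 𝟙 X : seqCoproduct (fun _ => X) ⟶ X) (by
      refine seqCoproduct_hom_ext fun n => ?_
      simp [Preadditive.sub_comp, Preadditive.comp_sub])
  refine ⟨q, ?_, ?_⟩
  · rw [Category.assoc, ← hq, seqι_desc]
  · rw [← cancel_epi p, ← reassoc_of% hq, Category.comp_id]
    refine seqCoproduct_hom_ext fun n => ?_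
    rw [seqι_desc_assoc, Category.id_comp]
    exact (hp n).symm

variable [IsTriangulated T]

/-- The canonical morphism from the first term of a sequence to its homotopy colimit. -/
lemma exists_trW_telescope (S : ObjectProperty T) [IsLocalising S] (ha : ∀ n, S.trW (a n))
    {H : T} {p : seqCoproduct A ⟶ H} {d : H ⟶ (seqCoproduct A)⟦(1 : ℤ)⟧}
    (hT : Triangle.mk (𝟙 _ - seqShift A a) p d ∈ distTriang T) :
    ∃ c : A 0 ⟶ H, S.trW c := by
  let k : ∀ n, A 0 ⟶ A n := fun n => Nat.rec (𝟙 _) (fun n f => f ≫ a n) n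
  have hk : ∀ n, S.trW (k n) := by
    intro n
    induction n with
    | zero => exact S.trW.id_mem _
    | succ n hn => exact S.trW.comp_mem _ _ hn (ha n)
  obtain ⟨H₀, p₀, d₀, hT₀⟩ :=
    distinguished_cocone_triangle (𝟙 _ - seqShift (fun _ => A 0) (fun _ => 𝟙 (A 0)))
  let θ : seqCoproduct (fun _ => A 0) ⟶ seqCoproduct A := seqDesc fun n => k n ≫ seqι A n
  have hθ : S.trW θ := by
    have : θ = Limits.Sigma.map fun i : ULift.{v} ℕ => k i.down :=
      seqCoproduct_hom_ext fun n => by simp [θ]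
    rw [this]
    exact trW_sigmaMap _ fun i => hk i.down
  have comm : (𝟙 _ - seqShift (fun _ => A 0) (fun _ => 𝟙 (A 0))) ≫ θ =
      θ ≫ (𝟙 _ - seqShift A a) := by
    refine seqCoproduct_hom_ext fun n => ?_
    simp [θ, k, Preadditive.sub_comp, Preadditive.comp_sub]
  -- Compare the telescope of the constant sequence `A 0` with that of `A`. The induced map of cones
  -- again has its cone in `S`, and the first cone is `A 0` itself.
  obtain ⟨c, hc, -, -⟩ := MorphismProperty.IsCompatibleWithTriangulation.compatible_with_triangulation
    (W := S.trW) _ _ hT₀ hT θ θ hθ hθ comm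
  have := isIso_seqι_zero_of_const (A 0) hT₀
  exact ⟨(seqι (fun _ => A 0) 0 ≫ p₀) ≫ c, S.trW.comp_mem _ _ (S.trW_of_isIso _) hc⟩

end Telescope

/-- Take the cone of the evaluation map from the coproduct of all morphisms from shifts of the `F
j`. New morphisms into the cone may appear, so the step has to be iterated. -/
lemma exists_trW_killing {J : Type v} (F : J → T) (S : ObjectProperty T) [IsLocalising S]
    (hS : ∀ j, S (F j)) (X : T) : ∃ (X' : T) (c : X ⟶ X'), S.trW c ∧
      ∀ (j : J) (m : ℤ) (f : (F j)⟦m⟧ ⟶ X), f ≫ c = 0 := by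
  let I := Σ p : J × ℤ, ((F p.1)⟦p.2⟧ ⟶ X)
  let K : I → T := fun i => (F i.1.1)⟦i.1.2⟧
  obtain ⟨X', c, d, hT⟩ := distinguished_cocone_triangle (Sigma.desc fun i : I => i.2 : ∐ K ⟶ X)
  refine ⟨X', c, ObjectProperty.trW.mk' _ hT
    (IsLocalising.coproduct fun i => S.le_shift _ _ (hS _)), fun j m f => ?_⟩
  have h := Sigma.ι K ⟨(j, m), f⟩ ≫= dist_comp₁₂ hT
  rwa [Sigma.ι_desc_assoc, comp_zero] at h

variable [IsTriangulated T]

/-- Bousfield localisation at a set of compact objects. -/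
theorem exists_trW_orthogonal {J : Type v} (F : J → T) (hF : ∀ j, IsCompactObject (F j))
    (S : ObjectProperty T) [IsLocalising S] (hS : ∀ j, S (F j)) (X : T) :
    ∃ (L : T) (c : X ⟶ L), S.trW c ∧ ∀ (j : J) (m : ℤ) (f : (F j)⟦m⟧ ⟶ L), f = 0 := by
  choose E e he₁ he₂ using exists_trW_killing F S hS
  let A : ℕ → T := fun n => Nat.rec X (fun _ Y => E Y) n
  let a : ∀ n, A n ⟶ A (n + 1) := fun n => e (A n)
  obtain ⟨H, p, d, hT⟩ := distinguished_cocone_triangle (𝟙 _ - seqShift A a)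
  obtain ⟨c, hc⟩ := exists_trW_telescope A a S (fun n => he₁ _) hT
  refine ⟨H, c, hc, fun j m g => ?_⟩
  -- By compactness it suffices to test single terms, where each transition kills everything. Hence
  -- composition with `1 - shift` is the identity on such morphisms, which makes first `g ≫ d` and
  -- then `g` vanish.
  have hs : ∀ (n : ℤ) (f : (F j)⟦n⟧ ⟶ seqCoproduct A), f ≫ seqShift A a = 0 := fun n f =>
    ((hF j).shift n).comp_eq_zero _ (fun i g => by
      have : g ≫ a i.down = 0 := he₂ _ _ _ _
      rw [seqι_shift, reassoc_of% this, zero_comp]) f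
  have hs' : ∀ f : (F j)⟦m⟧ ⟶ (seqCoproduct A)⟦(1 : ℤ)⟧, f ≫ (seqShift A a)⟦(1 : ℤ)⟧' = 0 := by
    intro f
    let i := (shiftFunctorAdd' T (m - 1) 1 m (by lia)).app (F j)
    obtain ⟨f', hf'⟩ := (shiftFunctor T (1 : ℤ)).map_surjective (i.inv ≫ f)
    rw [← cancel_epi i.inv, ← Category.assoc, ← hf', ← Functor.map_comp, hs, Functor.map_zero,
      comp_zero]
  have hgd : g ≫ d = 0 := by
    have h := g ≫= dist_comp₃₁ hT
    have h' := hs' (g ≫ d)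
    rw [Category.assoc] at h'
    rwa [Functor.map_sub, CategoryTheory.Functor.map_id, Preadditive.comp_sub,
      Preadditive.comp_sub, h', sub_zero, Category.comp_id, comp_zero] at h
  obtain ⟨k, rfl⟩ := dist_lift₃ hT g hgd
  have hk : k = k ≫ (𝟙 _ - seqShift A a) := by
    rw [Preadditive.comp_sub, Category.comp_id, hs, sub_zero]
  have h := dist_comp₁₂ hT
  rw [hk, Category.assoc, h, comp_zero]

end Localisation

/-! ### The action of endomorphisms of the unit -/

section UnitAction

open Pretriangulated

variable {T : Type u} [Category.{v} T] [Preadditive T] [HasZeroObject T] [HasShift T ℤ]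
  [∀ n : ℤ, (shiftFunctor T n).Additive] [Pretriangulated T]
  [MonoidalCategory T] [(curriedTensor T).CommShift₂Int]

lemma shiftTensorIso_naturality_left (n : ℤ) {X X' : T} (f : X ⟶ X') (Y : T) :
    f⟦n⟧' ▷ Y ≫ (shiftTensorIso n X' Y).hom = (shiftTensorIso n X Y).hom ≫ (f ▷ Y)⟦n⟧' :=
  ((tensorRight Y).commShiftIso n).hom.naturality f

lemma shiftTensorIso_naturality_right (n : ℤ) (X : T) {Y Y' : T} (f : Y ⟶ Y') :
    X⟦n⟧ ◁ f ≫ (shiftTensorIso n X Y').hom = (shiftTensorIso n X Y).hom ≫ (X ◁ f)⟦n⟧' :=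
  (NatTrans.shift_app_comm ((curriedTensor T).flip.map f) n X).symm

lemma tensorShiftIso_naturality_left (n : ℤ) {X X' : T} (f : X ⟶ X') (Y : T) :
    f ▷ Y⟦n⟧ ≫ (tensorShiftIso n X' Y).hom = (tensorShiftIso n X Y).hom ≫ (f ▷ Y)⟦n⟧' :=
  (NatTrans.shift_app_comm ((curriedTensor T).map f) n Y).symm

lemma tensorShiftIso_shiftTensorIso (m n : ℤ) (X Y : T) :
    (tensorShiftIso n (X⟦m⟧) Y).hom ≫ (shiftTensorIso m X Y).hom⟦n⟧' =
      Int.negOnePow (m * n) • ((shiftTensorIso m X (Y⟦n⟧)).hom ≫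
        (tensorShiftIso n X Y).hom⟦m⟧' ≫ (shiftComm (X ⊗ Y) n m).hom) := by
  have h := (curriedTensor T).commShift₂_comm .int X Y m n
  have h' : ((shiftComm (((curriedTensor T).obj X).obj Y) m n).inv) =
      (shiftComm (X ⊗ Y) n m).hom := by rw [← shiftComm_symm]; rfl
  rw [h'] at h
  refine h.trans ?_
  rw [CommShift₂Setup.int_ε, CatCenter.app_neg_one_zpow, Units.smul_def, Units.smul_def]
  erw [Preadditive.comp_zsmul, Preadditive.comp_zsmul, Preadditive.comp_zsmul, Category.comp_id]
  rfl

/-- The action of a homogeneous endomorphism of the unit on an object. -/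
noncomputable def unitAct {n : ℤ} (e : 𝟙_ T ⟶ (𝟙_ T)⟦n⟧) (X : T) : X ⟶ X⟦n⟧ :=
  (λ_ X).inv ≫ (e ▷ X) ≫ (shiftTensorIso n (𝟙_ T) X).hom ≫ (λ_ X).hom⟦n⟧'

variable {n : ℤ} (e : 𝟙_ T ⟶ (𝟙_ T)⟦n⟧)

lemma unitAct_naturality {X Y : T} (f : X ⟶ Y) :
    unitAct e X ≫ f⟦n⟧' = f ≫ unitAct e Y := by
  rw [unitAct, unitAct, Category.assoc, Category.assoc, Category.assoc, ← Functor.map_comp,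
    ← leftUnitor_naturality, Functor.map_comp, ← reassoc_of% shiftTensorIso_naturality_right,
    ← whisker_exchange_assoc, leftUnitor_inv_naturality_assoc]

end UnitAction

/-! ### Signs, shifts and Koszul objects -/

section Coherence

open Pretriangulated

variable {T : Type u} [Category.{v} T] [Preadditive T] [HasZeroObject T] [HasShift T ℤ]
  [∀ n : ℤ, (shiftFunctor T n).Additive] [Pretriangulated T] [IsTriangulated T]
  [HasCoproducts.{v} T] [MonoidalCategory T] [SymmetricCategory T]
  [(curriedTensor T).CommShift₂Int] [IsTensorTriangulated T]

variable {n : ℤ} (e : 𝟙_ T ⟶ (𝟙_ T)⟦n⟧)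

lemma shiftTensorIso_tensorShiftIso (m n : ℤ) (X Y : T) :
    (shiftTensorIso m X (Y⟦n⟧)).hom ≫ (tensorShiftIso n X Y).hom⟦m⟧' =
      Int.negOnePow (m * n) • ((tensorShiftIso n (X⟦m⟧) Y).hom ≫ (shiftTensorIso m X Y).hom⟦n⟧' ≫
        (shiftComm (X ⊗ Y) m n).hom) := by
  have h := tensorShiftIso_shiftTensorIso m n X Y =≫ (shiftComm (X ⊗ Y) m n).hom
  rw [Category.assoc] at h
  rw [h, Units.smul_def, Units.smul_def, Preadditive.zsmul_comp, ← mul_smul, ← Units.val_mul,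
    Int.units_mul_self, Units.val_one, one_smul, Category.assoc, Category.assoc]
  have h' : (shiftComm (X ⊗ Y) n m).hom ≫ (shiftComm (X ⊗ Y) m n).hom = 𝟙 _ := by
    rw [← shiftComm_symm, Iso.symm_hom, Iso.inv_hom_id]
  rw [h', Category.comp_id]

/-- The action is built from the shift in the first tensor factor, whereas the unitor of `X⟦a⟧`
involves the shift in the second. Interchanging the two produces the sign. -/
lemma unitAct_shift (X : T) (a : ℤ) :
    unitAct e (X⟦a⟧) = Int.negOnePow (n * a) • ((unitAct e X)⟦a⟧' ≫ (shiftComm X n a).hom) := by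
  rw [unitAct, Iso.inv_comp_eq, unitAct]
  have h : (λ_ (X⟦a⟧)).hom ≫ (λ_ X).inv⟦a⟧' = (tensorShiftIso a (𝟙_ T) X).hom := by
    rw [← IsTensorTriangulated.shift_leftUnitor, Category.assoc, ← Functor.map_comp,
      Iso.hom_inv_id, CategoryTheory.Functor.map_id, Category.comp_id]
  simp only [Functor.map_comp, Category.assoc]
  rw [Units.smul_def, Preadditive.comp_zsmul, reassoc_of% h,
    ← reassoc_of% tensorShiftIso_naturality_left, ← IsTensorTriangulated.shift_leftUnitor,
    Functor.map_comp, reassoc_of% shiftTensorIso_tensorShiftIso, Units.smul_def,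
    Preadditive.zsmul_comp, Preadditive.comp_zsmul]
  congr 2
  simp only [Category.assoc]
  rw [shiftComm_hom_comp]

/-- The sign is a unit, so it is irrelevant for annihilation, the only thing that matters later. -/
lemma comp_unitAct_shift_eq_zero_iff {X C : T} {a : ℤ} (f : C ⟶ X⟦a⟧) :
    f ≫ unitAct e (X⟦a⟧) = 0 ↔ f ≫ (unitAct e X)⟦a⟧' = 0 := by
  rw [unitAct_shift, Units.smul_def, Preadditive.comp_zsmul, ← Category.assoc]
  refine ⟨fun h => ?_, fun h => by rw [h, zero_comp, smul_zero]⟩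
  rw [← Units.smul_def, smul_eq_zero_iff_eq] at h
  rwa [← cancel_mono (shiftComm X n a).hom, zero_comp]

lemma unitAct_shift_self (X : T) :
    unitAct e (X⟦n⟧) = Int.negOnePow (n * n) • (unitAct e X)⟦n⟧' := by
  have h : (shiftComm X n n).hom = 𝟙 _ := by
    rw [shiftComm, shiftFunctorComm_eq_refl]; rfl
  rw [unitAct_shift, h]
  congr 1
  exact Category.comp_id _

variable (T) in
/-- A homogeneous endomorphism of the unit object. -/
abbrev UnitEnd : Type v := Σ n : ℤ, (𝟙_ T ⟶ (𝟙_ T)⟦n⟧)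

/-- The Koszul object of a homogeneous endomorphism of the unit: its cone. -/
noncomputable def koszul (e : UnitEnd T) : T := (distinguished_cocone_triangle e.2).choose

/-- This is the triangle defining `koszul e`, tensored with `X` and rewritten along the unitors. -/
lemma koszul_triangle (e : UnitEnd T) (X : T) :
    ∃ (p : X⟦e.1⟧ ⟶ koszul e ⊗ X) (d : koszul e ⊗ X ⟶ X⟦(1 : ℤ)⟧),
      Triangle.mk (unitAct e.2 X) p d ∈ distTriang T := by
  obtain ⟨g, h, hT⟩ := (distinguished_cocone_triangle e.2).choose_spec
  have := IsTensorTriangulated.exact_tensorRight X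
  have h' := (tensorRight X).map_distinguished _ hT
  let i : X⟦e.1⟧ ≅ (𝟙_ T)⟦e.1⟧ ⊗ X :=
    (shiftFunctor T e.1).mapIso (λ_ X).symm ≪≫ (shiftTensorIso e.1 (𝟙_ T) X).symm
  refine ⟨i.hom ≫ g ▷ X, h ▷ X ≫ (shiftTensorIso 1 (𝟙_ T) X).hom ≫ (λ_ X).hom⟦(1 : ℤ)⟧',
    isomorphic_distinguished _ h' _ (Triangle.isoMk _ _ (λ_ X).symm i (Iso.refl _) ?_ ?_ ?_)⟩
  · change unitAct e.2 X ≫ i.hom = (λ_ X).inv ≫ e.2 ▷ X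
    rw [unitAct]
    simp only [i, Iso.trans_hom, Functor.mapIso_hom, Iso.symm_hom, Category.assoc]
    rw [← Functor.map_comp_assoc, Iso.hom_inv_id, CategoryTheory.Functor.map_id, Category.id_comp,
      Iso.hom_inv_id, Category.comp_id]
  · change (i.hom ≫ g ▷ X) ≫ 𝟙 _ = i.hom ≫ g ▷ X
    rw [Category.comp_id]
  · change (h ▷ X ≫ (shiftTensorIso 1 (𝟙_ T) X).hom ≫ (λ_ X).hom⟦(1 : ℤ)⟧') ≫
      (λ_ X).inv⟦(1 : ℤ)⟧' = 𝟙 _ ≫ h ▷ X ≫ (shiftTensorIso 1 (𝟙_ T) X).hom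
    rw [Category.assoc, Category.assoc, ← Functor.map_comp, Iso.hom_inv_id,
      CategoryTheory.Functor.map_id, Category.comp_id, Category.id_comp]

/-- The square of an endomorphism of the unit annihilates its Koszul objects. -/
lemma unitAct_comp_unitAct_koszul (e : UnitEnd T) (X : T) :
    unitAct e.2 (koszul e ⊗ X) ≫ (unitAct e.2 (koszul e ⊗ X))⟦e.1⟧' = 0 := by
  obtain ⟨p, d, hT⟩ := koszul_triangle e X
  -- The action on the cone vanishes after `d`, hence lifts along `p`; it also vanishes when
  -- preceded by `p`. Composing it with itself therefore gives zero.
  have h₁ : unitAct e.2 (koszul e ⊗ X) ≫ d⟦e.1⟧' = 0 := by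
    rw [unitAct_naturality, comp_unitAct_shift_eq_zero_iff]
    exact dist_comp₃₁ hT
  obtain ⟨g, hg⟩ := dist_shift_lift₃ hT _ h₁
  have h₂ : p ≫ unitAct e.2 (koszul e ⊗ X) = 0 := by
    rw [← unitAct_naturality, unitAct_shift_self, Units.smul_def, Preadditive.zsmul_comp,
      ← Functor.map_comp, dist_comp₁₂ hT, Functor.map_zero, smul_zero]
  conv_lhs => enter [1]; rw [hg]
  rw [Category.assoc, ← Functor.map_comp, h₂, Functor.map_zero, comp_zero]

/-- The Koszul object of a sequence of endomorphisms of the unit. -/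
noncomputable def koszulSeq : List (UnitEnd T) → T
  | [] => 𝟙_ T
  | e :: l => koszul e ⊗ koszulSeq l

/-- Tensoring with the Koszul object of the empty sequence changes nothing. -/
noncomputable def koszulSeqNilIso (X : T) : koszulSeq ([] : List (UnitEnd T)) ⊗ X ≅ X :=
  λ_ X

/-- The Koszul object of a sequence followed by a tensor product, computed one step at a time. -/
noncomputable def koszulSeqConsIso (e : UnitEnd T) (l : List (UnitEnd T)) (X : T) :
    koszulSeq (e :: l) ⊗ X ≅ koszul e ⊗ (koszulSeq l ⊗ X) :=
  α_ _ _ _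

/-- Interchanging two tensor factors. -/
def tensorSwapIso (X Y Z : T) : X ⊗ (Y ⊗ Z) ≅ Y ⊗ (X ⊗ Z) :=
  (α_ X Y Z).symm ≪≫ whiskerRightIso (β_ X Y) Z ≪≫ α_ Y X Z

/-- Any element of a sequence can be moved to the front of its Koszul object. -/
lemma exists_koszulSeq_iso {e : UnitEnd T} {l : List (UnitEnd T)} (he : e ∈ l) (X : T) :
    ∃ Y : T, Nonempty (koszulSeq l ⊗ X ≅ koszul e ⊗ Y) := by
  induction l with
  | nil => simp at he
  | cons e' l ih =>
    rcases List.mem_cons.1 he with rfl | h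
    · exact ⟨_, ⟨koszulSeqConsIso _ _ _⟩⟩
    · obtain ⟨Y, ⟨i⟩⟩ := ih h
      exact ⟨_, ⟨koszulSeqConsIso _ _ _ ≪≫ whiskerLeftIso _ i ≪≫ tensorSwapIso _ _ _⟩⟩

/-- A triangulated subcategory is stable under tensoring with Koszul objects. -/
lemma prop_koszul_tensor (S : ObjectProperty T) [S.IsTriangulated] [S.IsClosedUnderIsomorphisms]
    (e : UnitEnd T) {X : T} (hX : S X) : S (koszul e ⊗ X) := by
  obtain ⟨p, d, hT⟩ := koszul_triangle e X
  exact S.ext_of_isTriangulatedClosed₃ _ hT hX (S.le_shift _ _ hX)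

lemma prop_koszulSeq_tensor (S : ObjectProperty T) [S.IsTriangulated]
    [S.IsClosedUnderIsomorphisms] (l : List (UnitEnd T)) {X : T} (hX : S X) :
    S (koszulSeq l ⊗ X) := by
  induction l with
  | nil => exact S.prop_of_iso (koszulSeqNilIso X).symm hX
  | cons e l ih => exact S.prop_of_iso (koszulSeqConsIso e l X).symm (prop_koszul_tensor S e ih)

lemma unitAct_comp_unitAct_naturality {X Y : T} (f : X ⟶ Y) :
    f ≫ unitAct e Y ≫ (unitAct e Y)⟦n⟧' = unitAct e X ≫ (unitAct e X)⟦n⟧' ≫ f⟦n⟧'⟦n⟧' := by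
  rw [← Category.assoc, ← unitAct_naturality, Category.assoc, ← Functor.map_comp,
    ← unitAct_naturality, Functor.map_comp]

end Coherence

/-! ### Koszul objects and orthogonality, without duals -/

section Orthogonality

open Pretriangulated

section

variable {T : Type u} [Category.{v} T] [Preadditive T] [HasShift T ℤ]
  [∀ n : ℤ, (shiftFunctor T n).Additive]

lemma hom_shift_eq_zero {A B : T} {n : ℤ} (h : ∀ f : A⟦-n⟧ ⟶ B, f = 0) (f : A ⟶ B⟦n⟧) :
    f = 0 := by
  obtain ⟨f', hf'⟩ := (shiftFunctor T n).map_surjective ((shiftNegShift A n).hom ≫ f)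
  rw [h f', Functor.map_zero] at hf'
  rw [← cancel_epi (shiftNegShift A n).hom, ← hf', comp_zero]

lemma hom_from_shift_eq_zero {A B : T} {n : ℤ} (h : ∀ f : A ⟶ B⟦-n⟧, f = 0) (f : A⟦n⟧ ⟶ B) :
    f = 0 := by
  obtain ⟨f', hf'⟩ := (shiftFunctor T n).map_surjective (f ≫ (shiftNegShift B n).inv)
  rw [h f', Functor.map_zero] at hf'
  rw [← cancel_mono (shiftNegShift B n).inv, ← hf', zero_comp]

/-- The objects isomorphic to a shift of a given object. -/
def shiftsOf (X : T) : ObjectProperty T := fun Y => ∃ n : ℤ, Nonempty (Y ≅ X⟦n⟧)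

instance (X : T) : (shiftsOf X).IsStableUnderShift ℤ where
  isStableUnderShiftBy m := ⟨fun _ ⟨n, ⟨i⟩⟩ =>
    ⟨n + m, ⟨(shiftFunctor T m).mapIso i ≪≫ ((shiftFunctorAdd T n m).app X).symm⟩⟩⟩

lemma shiftsOf_self (X : T) : shiftsOf X X :=
  ⟨0, ⟨((shiftFunctorZero T ℤ).app X).symm⟩⟩

lemma leftOrthogonal_shiftsOf {X Y : T} (h : ∀ (n : ℤ) (f : X⟦n⟧ ⟶ Y), f = 0) :
    (shiftsOf Y).leftOrthogonal X := by
  rintro Z f ⟨n, ⟨i⟩⟩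
  rw [← cancel_mono i.hom, hom_shift_eq_zero (h (-n)) (f ≫ i.hom), zero_comp]

lemma rightOrthogonal_shiftsOf {X Y : T} (h : ∀ (n : ℤ) (f : X ⟶ Y⟦n⟧), f = 0) :
    (shiftsOf X).rightOrthogonal Y := by
  rintro Z f ⟨n, ⟨i⟩⟩
  rw [← cancel_epi i.inv, hom_from_shift_eq_zero (h (-n)) (i.inv ≫ f), comp_zero]

end

variable {T : Type u} [Category.{v} T] [Preadditive T] [HasZeroObject T] [HasShift T ℤ]
  [∀ n : ℤ, (shiftFunctor T n).Additive] [Pretriangulated T] [IsTriangulated T]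
  [HasCoproducts.{v} T] [MonoidalCategory T] [SymmetricCategory T]
  [(curriedTensor T).CommShift₂Int] [IsTensorTriangulated T]

/-- The hypothesis makes composition with `e` injective on morphisms from `P` to `Y`. On `koszul e ⊗
W`, which lies in `P`, the square of `e` is zero, so naturality gives `f ≫ e ≫ e = 0`; cancel twice.
-/
lemma hom_koszul_eq_zero (P : ObjectProperty T) [P.IsTriangulated] [P.IsClosedUnderIsomorphisms]
    (e : UnitEnd T) {Y : T} (h : ∀ W, P W → ∀ f : W ⟶ koszul e ⊗ Y, f = 0) {W : T} (hW : P W)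
    (f : koszul e ⊗ W ⟶ Y) : f = 0 := by
  obtain ⟨p, d, hT⟩ := koszul_triangle e Y
  have inj : ∀ (D : T), P D → ∀ g : D ⟶ Y, g ≫ unitAct e.2 Y = 0 → g = 0 := by
    intro D hD g hg
    obtain ⟨l, hl⟩ := dist_lift₁ hT (g⟦(1 : ℤ)⟧') (by
      rw [← Functor.map_comp, hg, Functor.map_zero])
    rw [h _ (P.le_shift _ _ hD) l, zero_comp] at hl
    exact (shiftFunctor T (1 : ℤ)).map_injective (by rw [hl, Functor.map_zero])
  have hD := prop_koszul_tensor P e hW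
  refine inj _ hD _ ?_
  have h₂ : (f ≫ unitAct e.2 Y) ≫ (unitAct e.2 Y)⟦e.1⟧' = 0 := by
    rw [Category.assoc, unitAct_comp_unitAct_naturality,
      reassoc_of% unitAct_comp_unitAct_koszul, zero_comp]
  obtain ⟨g, hg⟩ := (shiftFunctor T e.1).map_surjective
    ((shiftNegShift (koszul e ⊗ W) e.1).hom ≫ f ≫ unitAct e.2 Y)
  rw [inj _ (P.le_shift (-e.1) _ hD) g ((shiftFunctor T e.1).map_injective (by
    rw [Functor.map_comp, hg, Category.assoc, h₂, comp_zero, Functor.map_zero])),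
    Functor.map_zero] at hg
  rw [← cancel_epi (shiftNegShift (koszul e ⊗ W) e.1).hom, ← hg, comp_zero]

/-- Dual to `hom_koszul_eq_zero`: now `e` is cancelled at the source `W`, and its square vanishes on
the target. -/
lemma hom_to_koszul_eq_zero (Q : ObjectProperty T) [Q.IsTriangulated]
    [Q.IsClosedUnderIsomorphisms] (e : UnitEnd T) {W : T}
    (h : ∀ Y, Q Y → ∀ f : koszul e ⊗ W ⟶ Y, f = 0) {Y : T} (hY : Q Y)
    (f : W ⟶ koszul e ⊗ Y) : f = 0 := by
  obtain ⟨p, d, hT⟩ := koszul_triangle e W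
  have inj : ∀ (D : T), Q D → ∀ g : W⟦e.1⟧ ⟶ D, unitAct e.2 W ≫ g = 0 → g = 0 := by
    intro D hD g hg
    obtain ⟨l, rfl⟩ := dist_desc₂ hT g hg
    rw [h _ hD l, comp_zero]
  have hD := Q.le_shift e.1 _ (prop_koszul_tensor Q e hY)
  have h₂ := unitAct_comp_unitAct_naturality e.2 f
  rw [unitAct_comp_unitAct_koszul, comp_zero] at h₂
  have h₃ := inj _ (Q.le_shift e.1 _ hD) _ h₂.symm
  rw [← Functor.map_comp] at h₃
  have h₄ := inj _ hD (f⟦e.1⟧') ((shiftFunctor T e.1).map_injective (by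
    rw [h₃, Functor.map_zero]))
  exact (shiftFunctor T e.1).map_injective (by rw [h₄, Functor.map_zero])

/-- The class `P` varies so that the induction closes: after one element has been moved across, the
class becomes the left orthogonal of the shifts of `koszulSeq l ⊗ Y`. -/
lemma hom_koszulSeq_eq_zero (l : List (UnitEnd T)) (P : ObjectProperty T) [P.IsTriangulated]
    [P.IsClosedUnderIsomorphisms] {Y : T} (h : ∀ W, P W → ∀ f : W ⟶ koszulSeq l ⊗ Y, f = 0)
    {W : T} (hW : P W) (f : koszulSeq l ⊗ W ⟶ Y) : f = 0 := by
  induction l generalizing P W with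
  | nil =>
    have := h W hW ((koszulSeqNilIso W).inv ≫ f ≫ (koszulSeqNilIso Y).inv)
    rwa [← cancel_mono (koszulSeqNilIso Y).inv, ← cancel_epi (koszulSeqNilIso W).inv, zero_comp, comp_zero]
  | cons e l ih =>
    have h₁ : ∀ W, P W → (shiftsOf (koszulSeq l ⊗ Y)).leftOrthogonal (koszul e ⊗ W) := by
      refine fun W hW => leftOrthogonal_shiftsOf fun n f => ?_
      rw [← cancel_epi (tensorShiftIso n (koszul e) W).hom, comp_zero]
      refine hom_koszul_eq_zero P e (fun W' hW' g => ?_) (P.le_shift n _ hW) _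
      rw [← cancel_mono (koszulSeqConsIso e l Y).inv, zero_comp]
      exact h W' hW' _
    let i := koszulSeqConsIso e l W ≪≫ tensorSwapIso _ _ _
    rw [← cancel_epi i.inv, comp_zero]
    exact ih (shiftsOf (koszulSeq l ⊗ Y)).leftOrthogonal
      (fun W hW g => hW g (shiftsOf_self _)) (h₁ W hW) _

lemma hom_to_koszulSeq_eq_zero (l : List (UnitEnd T)) (Q : ObjectProperty T) [Q.IsTriangulated]
    [Q.IsClosedUnderIsomorphisms] {W : T} (h : ∀ Y, Q Y → ∀ f : koszulSeq l ⊗ W ⟶ Y, f = 0)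
    {Y : T} (hY : Q Y) (f : W ⟶ koszulSeq l ⊗ Y) : f = 0 := by
  induction l generalizing Q Y with
  | nil =>
    have := h Y hY ((koszulSeqNilIso W).hom ≫ f ≫ (koszulSeqNilIso Y).hom)
    rwa [← cancel_mono (koszulSeqNilIso Y).hom, ← cancel_epi (koszulSeqNilIso W).hom, zero_comp, comp_zero]
  | cons e l ih =>
    have h₁ : ∀ Y, Q Y → (shiftsOf (koszulSeq l ⊗ W)).rightOrthogonal (koszul e ⊗ Y) := by
      refine fun Y hY => rightOrthogonal_shiftsOf fun n f => ?_
      rw [← cancel_mono (tensorShiftIso n (koszul e) Y).inv, zero_comp]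
      refine hom_to_koszul_eq_zero Q e (fun Y' hY' g => ?_) (Q.le_shift n _ hY) _
      rw [← cancel_epi (koszulSeqConsIso e l W).hom, comp_zero]
      exact h Y' hY' _
    let i := koszulSeqConsIso e l Y ≪≫ tensorSwapIso _ _ _
    rw [← cancel_mono i.hom, zero_comp]
    exact ih (shiftsOf (koszulSeq l ⊗ W)).rightOrthogonal
      (fun W hW g => hW g (shiftsOf_self _)) (h₁ Y hY) _

/-- All morphisms from Koszul objects to `Y` vanish exactly if `Y` is annihilated by tensoring
with the Koszul object. -/
lemma isZero_koszulSeq_tensor_iff (l : List (UnitEnd T)) (Y : T) :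
    IsZero (koszulSeq l ⊗ Y) ↔ ∀ (W : T) (f : koszulSeq l ⊗ W ⟶ Y), f = 0 := by
  refine ⟨fun h W f => hom_koszulSeq_eq_zero l (shiftsOf (koszulSeq l ⊗ Y)).leftOrthogonal
    (fun W hW g => hW g (shiftsOf_self _)) (leftOrthogonal_shiftsOf fun n g => h.eq_of_tgt _ _) f,
    fun h => ?_⟩
  rw [IsZero.iff_id_eq_zero]
  -- Applied to the identity of `K ⊗ Y`, where `K = koszulSeq l`: `Y` is right orthogonal to the
  -- shifts of `K ⊗ (K ⊗ Y)` by hypothesis.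
  refine hom_to_koszulSeq_eq_zero l (shiftsOf (koszulSeq l ⊗ (koszulSeq l ⊗ Y))).rightOrthogonal
    (fun Y' hY' f => hY' f (shiftsOf_self _)) (rightOrthogonal_shiftsOf fun n f => ?_) _
  refine hom_shift_eq_zero (fun g => ?_) f
  rw [← cancel_epi (tensorShiftIso _ _ _).hom, comp_zero]
  exact h _ _

end Orthogonality

/-! ### Examples of localising subcategories -/

section Localising

open Pretriangulated

variable {T : Type u} [Category.{v} T] [Preadditive T] [HasZeroObject T] [HasShift T ℤ]
  [∀ n : ℤ, (shiftFunctor T n).Additive] [Pretriangulated T] [HasCoproducts.{v} T]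

variable (T) in
/-- The full subcategory of zero objects. -/
def zeroObjects : ObjectProperty T := IsZero

lemma isZero_coproduct {J : Type v} {Y : J → T} (h : ∀ j, IsZero (Y j)) : IsZero (∐ Y) := by
  rw [IsZero.iff_id_eq_zero]
  exact Limits.Sigma.hom_ext _ _ fun j => (h j).eq_of_src _ _

instance : (zeroObjects T).IsClosedUnderIsomorphisms where
  of_iso e h := IsZero.of_iso h e.symm

instance : IsLocalising (zeroObjects T) :=
  have : (zeroObjects T).IsTriangulated :=
    { exists_zero := ⟨_, isZero_zero T, isZero_zero T⟩
      isStableUnderShiftBy := fun n => ⟨fun _ h => (shiftFunctor T n).map_isZero h⟩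
      toIsTriangulatedClosed₂ := .mk' fun A hA h₁ h₃ => by
        refine (IsZero.iff_id_eq_zero _).2 ?_
        obtain ⟨k, hk⟩ := Triangle.coyoneda_exact₂ _ hA (𝟙 A.obj₂) (h₃.eq_of_tgt _ _)
        rw [hk, h₁.eq_of_tgt k 0, zero_comp] }
  .of_coproduct fun _ _ h => isZero_coproduct h

instance (X : T) : IsLocalising (shiftsOf X).leftOrthogonal :=
  .of_coproduct fun _ _ h Z f hZ => Limits.Sigma.hom_ext _ _ fun j => by
    rw [h j (Sigma.ι _ j ≫ f) hZ, comp_zero]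

lemma isLocalising_inverseImage (S : ObjectProperty T) [IsLocalising S] (F : T ⥤ T)
    [F.CommShift ℤ] [F.IsTriangulated]
    (hF : ∀ J : Type v, PreservesColimitsOfShape (Discrete J) F) :
    IsLocalising (S.inverseImage F) :=
  .of_coproduct fun J Y h => S.prop_of_iso (PreservesCoproduct.iso F Y).symm
    (IsLocalising.coproduct h)

/-- In a compactly generated category compact objects detect non-zero objects. -/
lemma IsCompactlyGenerated.exists_ne_zero (hgen : IsCompactlyGenerated T) {X : T}
    (hX : ¬ IsZero X) : ∃ C : T, IsCompactObject C ∧ ∃ f : C ⟶ X, f ≠ 0 := by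
  by_contra! h
  obtain ⟨ι, G, hG, hG'⟩ := hgen
  refine hX ((IsZero.iff_id_eq_zero _).2 ?_)
  -- The objects without morphisms to shifts of `X` form a localising subcategory. It contains the
  -- generators, hence `X`, so the identity of `X` is zero.
  exact hG' (shiftsOf X).leftOrthogonal inferInstance (fun i => leftOrthogonal_shiftsOf
    fun n => h _ ((hG i).shift n)) X _ (shiftsOf_self X)

end Localising

/-! ### Tensor products and localising subcategories -/

section TensorLocalising

variable {T : Type u} [Category.{v} T] [Preadditive T] [HasZeroObject T] [HasShift T ℤ]
  [∀ n : ℤ, (shiftFunctor T n).Additive] [Pretriangulated T] [IsTriangulated T]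
  [HasCoproducts.{v} T] [MonoidalCategory T] [SymmetricCategory T]
  [(curriedTensor T).CommShift₂Int] [IsTensorTriangulated T]

instance (S : ObjectProperty T) [IsLocalising S] (X : T) :
    IsLocalising (S.inverseImage (tensorLeft X)) :=
  have := IsTensorTriangulated.exact_tensorLeft X
  isLocalising_inverseImage S (tensorLeft X) (IsTensorTriangulated.coproducts_tensorLeft X)

instance (S : ObjectProperty T) [IsLocalising S] (X : T) :
    IsLocalising (S.inverseImage (tensorRight X)) :=
  have := IsTensorTriangulated.exact_tensorRight X
  isLocalising_inverseImage S (tensorRight X) (IsTensorTriangulated.coproducts_tensorRight X)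

lemma isZero_tensor_left {X : T} (Y : T) (h : IsZero X) : IsZero (X ⊗ Y) := by
  have := IsTensorTriangulated.exact_tensorRight Y
  exact (tensorRight Y).map_isZero h

lemma isZero_tensor_right (X : T) {Y : T} (h : IsZero Y) : IsZero (X ⊗ Y) := by
  have := IsTensorTriangulated.exact_tensorLeft X
  exact (tensorLeft X).map_isZero h

end TensorLocalising

/-! ### Torsion objects form a localising subcategory -/

section Torsion

open Pretriangulated

variable {R : Type w} [Ring R] {𝒜 : ℤ → AddSubgroup R} [GradedRing 𝒜]
  {T : Type u} [Category.{v} T] [Preadditive T] [HasZeroObject T] [HasShift T ℤ]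
  [∀ n : ℤ, (shiftFunctor T n).Additive] [Pretriangulated T] [IsTriangulated T]
  [HasCoproducts.{v} T] [MonoidalCategory T] [SymmetricCategory T]
  [(curriedTensor T).CommShift₂Int] [IsTensorTriangulated T]

namespace CanonicalAction

variable (φ : CanonicalAction 𝒜 T)

lemma act_naturality {X Y : T} (f : X ⟶ Y) {n : ℤ} (r : 𝒜 n) :
    φ.act X r ≫ f⟦n⟧' = f ≫ φ.act Y r :=
  unitAct_naturality _ f

lemma act_add (X : T) {n : ℤ} (r s : 𝒜 n) : φ.act X (r + s) = φ.act X r + φ.act X s := by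
  have := IsTensorTriangulated.exact_tensorRight X
  have h : (φ.hom n r + φ.hom n s) ▷ X = φ.hom n r ▷ X + φ.hom n s ▷ X :=
    (tensorRight X).map_add
  simp only [act, map_add]
  rw [h, Preadditive.add_comp, Preadditive.comp_add]

lemma act_neg (X : T) {n : ℤ} (r : 𝒜 n) : φ.act X (-r) = - φ.act X r :=
  map_neg (AddMonoidHom.mk' (fun r : 𝒜 n => φ.act X r) (φ.act_add X)) r

lemma comp_act_eq_zero_iff {X C : T} (f : C ⟶ X) {n : ℤ} (r : 𝒜 n) :
    f ≫ φ.act X r = 0 ↔ (f ≫ (λ_ X).inv) ≫ φ.hom n r ▷ X = 0 := by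
  let i := shiftTensorIso n (𝟙_ T) X ≪≫ (shiftFunctor T n).mapIso (λ_ X)
  have : f ≫ φ.act X r = ((f ≫ (λ_ X).inv) ≫ φ.hom n r ▷ X) ≫ i.hom := by
    simp only [act, i, Iso.trans_hom, Functor.mapIso_hom, Category.assoc]
  rw [this, ← cancel_mono i.hom, zero_comp]

lemma comp_act_mul_eq_zero {X C : T} (f : C ⟶ X) {m n : ℤ} (r : 𝒜 m) (s : 𝒜 n)
    (h : f ≫ φ.act X s ≫ (φ.act X r)⟦n⟧' = 0) :
    f ≫ φ.act X (⟨r * s, SetLike.GradedMul.mul_mem r.2 s.2⟩ : 𝒜 (m + n)) = 0 := by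
  let i := (shiftFunctor T n).mapIso (shiftTensorIso m (𝟙_ T) X ≪≫
    (shiftFunctor T m).mapIso (λ_ X))
  have h₁ : f ≫ φ.act X s ≫ (φ.act X r)⟦n⟧' =
      (f ≫ (λ_ X).inv ≫ φ.hom n s ▷ X ≫ (φ.hom m r)⟦n⟧' ▷ X) ≫
        (shiftTensorIso n _ X).hom ≫ i.hom := by
    simp only [act, i, Iso.trans_hom, Functor.mapIso_hom, Category.assoc, Functor.map_comp]
    rw [← Functor.map_comp_assoc _ (λ_ X).hom, Iso.hom_inv_id, CategoryTheory.Functor.map_id,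
      Category.id_comp, reassoc_of% shiftTensorIso_naturality_left]
  rw [h₁, ← zero_comp (f := (shiftTensorIso n _ X).hom ≫ i.hom), cancel_mono] at h
  rw [comp_act_eq_zero_iff, φ.map_mul, ShiftedHom.comp, comp_whiskerRight, comp_whiskerRight]
  simp only [Category.assoc] at h ⊢
  rw [reassoc_of% h, zero_comp]

lemma smul_eq_zero_iff {C X : T} {n m : ℤ} (r : 𝒜 n) (f : ShiftedHom C X m) :
    φ.smul r f = 0 ↔ f ≫ (φ.act X r)⟦m⟧' = 0 := by
  rw [smul, ShiftedHom.comp, ← Category.assoc]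
  exact ⟨fun h => by rwa [← cancel_mono ((shiftFunctorAdd' T n m (n + m) rfl).inv.app X),
    zero_comp], fun h => by rw [h, zero_comp]⟩

/-- A morphism is annihilated by a homogeneous element outside the homogeneous prime `p`. -/
def Killed (p : HomogeneousSpec 𝒜) {C X : T} (f : C ⟶ X) : Prop :=
  ∃ (n : ℤ) (s : 𝒜 n), (s : R) ∉ p.ideal ∧ f ≫ φ.act X s = 0

variable {φ} {p : HomogeneousSpec 𝒜}

lemma not_mem_mul {r s : R} (hr : r ∉ p.ideal) (hs : s ∉ p.ideal) : r * s ∉ p.ideal :=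
  fun h => (p.2.mem_or_mem h).elim hr hs

lemma Killed.comp_right {C X Y : T} {f : C ⟶ X} (hf : φ.Killed p f) (g : X ⟶ Y) :
    φ.Killed p (f ≫ g) := by
  obtain ⟨n, s, hs, h⟩ := hf
  exact ⟨n, s, hs, by rw [Category.assoc, ← act_naturality, reassoc_of% h, zero_comp]⟩

lemma killed_zero (C X : T) : φ.Killed p (0 : C ⟶ X) :=
  ⟨0, ⟨1, SetLike.GradedOne.one_mem⟩, fun h => p.2.ne_top ((Ideal.eq_top_iff_one _).2 h),
    zero_comp⟩

lemma comp_act_eq_zero_congr {C X : T} (f : C ⟶ X) {n n' : ℤ} (h : n = n') {r : R}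
    (hr : r ∈ 𝒜 n) (hr' : r ∈ 𝒜 n') (hf : f ≫ φ.act X ⟨r, hr⟩ = 0) :
    f ≫ φ.act X ⟨r, hr'⟩ = 0 := by
  subst h
  exact hf

/-- If `r` kills `f` and `s` kills `g`, then `s * r` kills `f` and `r * s` kills `g`; by graded
commutativity the two products agree up to sign. -/
lemma Killed.add (hcomm : IsGradedCommutative 𝒜) {C X : T} {f g : C ⟶ X} (hf : φ.Killed p f)
    (hg : φ.Killed p g) : φ.Killed p (f + g) := by
  obtain ⟨m, r, hr, hf⟩ := hf
  obtain ⟨n, s, hs, hg⟩ := hg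
  refine ⟨m + n, ⟨r * s, SetLike.GradedMul.mul_mem r.2 s.2⟩, not_mem_mul hr hs, ?_⟩
  have h₁ := φ.comp_act_mul_eq_zero g r s (by rw [reassoc_of% hg, zero_comp])
  have h₂ := φ.comp_act_mul_eq_zero f s r (by rw [reassoc_of% hf, zero_comp])
  have h₃ := comp_act_eq_zero_congr f (add_comm n m) _
    (add_comm n m ▸ SetLike.GradedMul.mul_mem s.2 r.2) h₂
  rw [Preadditive.add_comp, h₁, add_zero]
  rcases Int.even_or_odd (m * n) with he | ho
  · have : (r * s : R) = s * r := by
      rw [hcomm m n r s r.2 s.2, Int.negOnePow_even _ he, one_smul]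
    simp only [this]
    exact h₃
  · have : (⟨r * s, SetLike.GradedMul.mul_mem r.2 s.2⟩ : 𝒜 (m + n)) =
        - ⟨s * r, add_comm n m ▸ SetLike.GradedMul.mul_mem s.2 r.2⟩ := by
      ext
      change (r * s : R) = - (s * r)
      rw [hcomm m n r s r.2 s.2, Int.negOnePow_odd _ ho, Units.neg_smul, one_smul]
    rw [this, act_neg, Preadditive.comp_neg, h₃, neg_zero]

lemma Killed.sum (hcomm : IsGradedCommutative 𝒜) {C X : T} {J : Type*} (s : Finset J)
    (f : J → (C ⟶ X)) (hf : ∀ j ∈ s, φ.Killed p (f j)) : φ.Killed p (∑ j ∈ s, f j) :=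
  Finset.sum_induction _ _ (fun _ _ => Killed.add hcomm) (killed_zero _ _) hf

variable (φ)

/-- Degree zero suffices because shifts of compact objects are compact. -/
lemma torsion_iff (V : Set (HomogeneousSpec 𝒜)) (X : T) : φ.torsion V X ↔
    ∀ C : T, IsCompactObject C → ∀ p, p ∉ V → ∀ f : C ⟶ X, φ.Killed p f := by
  refine ⟨fun h C hC p hp f => ?_, fun h C hC p hp m f => ?_⟩
  · let i := (shiftFunctorZero T ℤ).app X
    obtain ⟨n, s, hs, hf⟩ := h C hC p hp 0 (f ≫ i.inv)
    have hk : φ.Killed p (f ≫ i.inv) := ⟨n, s, hs,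
      (comp_unitAct_shift_eq_zero_iff (φ.hom n s) _).2 ((φ.smul_eq_zero_iff s _).1 hf)⟩
    simpa using hk.comp_right i.hom
  · obtain ⟨f', hf'⟩ := (shiftFunctor T m).map_surjective ((shiftNegShift C m).hom ≫ f)
    obtain ⟨n, s, hs, hf⟩ := h _ (hC.shift (-m)) p hp f'
    refine ⟨n, s, hs, ?_⟩
    rw [smul_eq_zero_iff, ← cancel_epi (shiftNegShift C m).hom, ← Category.assoc, ← hf',
      ← Functor.map_comp, hf, Functor.map_zero, comp_zero]

variable {φ} in
lemma torsion.killed_shift {V : Set (HomogeneousSpec 𝒜)} {X : T} (hX : φ.torsion V X) {C : T}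
    (hC : IsCompactObject C) (hp : p ∉ V) {m : ℤ} (f : C ⟶ X⟦m⟧) :
    ∃ (n : ℤ) (s : 𝒜 n), (s : R) ∉ p.ideal ∧ f ≫ (φ.act X s)⟦m⟧' = 0 := by
  obtain ⟨n, s, hs, hf⟩ := hX C hC p hp m f
  exact ⟨n, s, hs, (φ.smul_eq_zero_iff s f).1 hf⟩

instance (V : Set (HomogeneousSpec 𝒜)) : (φ.torsion V).IsClosedUnderIsomorphisms where
  of_iso e h := by
    rw [torsion_iff] at h ⊢
    intro C hC p hp f
    simpa using (h C hC p hp (f ≫ e.inv)).comp_right e.hom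

instance (V : Set (HomogeneousSpec 𝒜)) : (φ.torsion V).IsTriangulated where
  exists_zero := ⟨_, isZero_zero T, by
    rw [torsion_iff]
    intro C hC p hp f
    rw [(isZero_zero T).eq_of_tgt f 0]
    exact killed_zero _ _⟩
  isStableUnderShiftBy m := ⟨fun X hX => by
    change φ.torsion V (X⟦m⟧)
    rw [torsion_iff]
    intro C hC p hp f
    obtain ⟨n, s, hs, hf⟩ := hX.killed_shift hC hp f
    exact ⟨n, s, hs, (comp_unitAct_shift_eq_zero_iff _ f).2 hf⟩⟩
  toIsTriangulatedClosed₂ := .mk' fun A hA h₁ h₃ => by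
    obtain ⟨A, B, D, u, v, d⟩ := A
    change φ.torsion V B
    change φ.torsion V A at h₁
    change φ.torsion V D at h₃
    have hA : Triangle.mk u v d ∈ distTriang T := hA
    rw [torsion_iff] at h₃ ⊢
    intro C hC p hp f
    -- After acting by `s` the morphism lifts to the first vertex, where some `t` kills it. Thus `t
    -- * s` kills `f`.
    obtain ⟨n, s, hs, hf⟩ := h₃ C hC p hp (f ≫ v)
    obtain ⟨g, hg⟩ := dist_shift_lift₂ hA (f ≫ φ.act B s) (by
      rw [Category.assoc, act_naturality, ← Category.assoc, hf])
    obtain ⟨m, t, ht, hg'⟩ := h₁.killed_shift hC hp g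
    refine ⟨_, _, not_mem_mul ht hs, φ.comp_act_mul_eq_zero f t s ?_⟩
    rw [← Category.assoc, hg, Category.assoc, ← Functor.map_comp, ← act_naturality,
      Functor.map_comp, reassoc_of% hg', zero_comp]

/-- A morphism from a compact object to a coproduct is a finite sum of morphisms through single
terms, and finite sums of killed morphisms are killed. -/
lemma isLocalising_torsion (hcomm : IsGradedCommutative 𝒜) (V : Set (HomogeneousSpec 𝒜)) :
    IsLocalising (φ.torsion V) :=
  .of_coproduct fun J Y h => by
    classical
    rw [torsion_iff]
    intro C hC p hp f
    have hC' := hC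
    rw [isCompactObject_iff] at hC'
    obtain ⟨s, hs⟩ := hC' J Y f
    rw [← hs, coproductRestrict, Preadditive.comp_sum]
    refine Killed.sum hcomm s _ fun j _ => ?_
    rw [← Category.assoc]
    exact ((φ.torsion_iff V _).1 (h j) C hC p hp _).comp_right _

end CanonicalAction

end Torsion

/-! ### Koszul objects generate the torsion objects -/

section KoszulTorsion

open Pretriangulated

variable {R : Type w} [Ring R] {𝒜 : ℤ → AddSubgroup R} [GradedRing 𝒜]
  {T : Type u} [Category.{v} T] [Preadditive T] [HasZeroObject T] [HasShift T ℤ]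
  [∀ n : ℤ, (shiftFunctor T n).Additive] [Pretriangulated T] [IsTriangulated T]
  [HasCoproducts.{v} T] [MonoidalCategory T] [SymmetricCategory T]
  [(curriedTensor T).CommShift₂Int] [IsTensorTriangulated T]

namespace CanonicalAction

variable (φ : CanonicalAction 𝒜 T)

/-- The endomorphism of the unit given by a homogeneous element. -/
def unitEnd (x : Σ n, 𝒜 n) : UnitEnd T := ⟨x.1, φ.hom x.1 x.2⟩

/-- The sequence of endomorphisms of the unit comes from a sequence of homogeneous elements of `R`
such that all homogeneous primes containing it belong to `V`. -/
def IsSupportedOn (V : Set (HomogeneousSpec 𝒜)) (L : List (UnitEnd T)) : Prop :=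
  ∃ l : List (Σ n, 𝒜 n), l.map φ.unitEnd = L ∧ ∀ p ∉ V, ∃ x ∈ l, (x.2 : R) ∉ p.ideal

/-- For `p ∉ V` some entry `x` of the list lies outside `p`. Moved to the front, it acts with square
zero, and `x * x` is still outside `p`. -/
lemma torsion_koszulSeq {V : Set (HomogeneousSpec 𝒜)} {L : List (UnitEnd T)}
    (hL : φ.IsSupportedOn V L) (W : T) : φ.torsion V (koszulSeq L ⊗ W) := by
  obtain ⟨l, rfl, hl⟩ := hL
  rw [torsion_iff]
  intro C hC p hp f
  obtain ⟨x, hx, hxp⟩ := hl p hp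
  obtain ⟨Y, ⟨i⟩⟩ := exists_koszulSeq_iso (List.mem_map_of_mem (f := φ.unitEnd) hx) W
  have key : φ.Killed p (f ≫ i.hom) := by
    refine ⟨_, _, not_mem_mul hxp hxp, φ.comp_act_mul_eq_zero _ x.2 x.2 ?_⟩
    have := unitAct_comp_unitAct_koszul (φ.unitEnd x) Y
    exact ((f ≫ i.hom) ≫= this).trans comp_zero
  simpa using key.comp_right i.inv

variable [IsNoetherianRing R]

/-- Torsion objects are detected by Koszul objects supported on `V`. -/
lemma isZero_of_torsion (hgen : IsCompactlyGenerated T) {V : Set (HomogeneousSpec 𝒜)} {X : T}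
    (hX : φ.torsion V X)
    (h : ∀ L, φ.IsSupportedOn V L → ∀ (W : T) (f : koszulSeq L ⊗ W ⟶ X), f = 0) : IsZero X := by
  by_contra hX₀
  obtain ⟨C₀, hC₀, f₀, hf₀⟩ := hgen.exists_ne_zero hX₀
  -- Ideals spanned by lists whose Koszul object, tensored with some compact object, maps
  -- nontrivially to `X`. The empty list shows there is one; a maximal one exists since `R` is
  -- noetherian.
  let S : Set (Ideal R) := { I | ∃ l : List (Σ n, 𝒜 n), I = Ideal.span { r | ∃ x ∈ l, r = (x.2 : R) } ∧
    ∃ C : T, IsCompactObject C ∧ ∃ f : koszulSeq (l.map φ.unitEnd) ⊗ C ⟶ X, f ≠ 0 }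
  have hS : S.Nonempty := by
    refine ⟨_, [], rfl, C₀, hC₀, (koszulSeqNilIso C₀).hom ≫ f₀, fun h => hf₀ ?_⟩
    rwa [← cancel_epi (koszulSeqNilIso C₀).hom, comp_zero]
  obtain ⟨I, ⟨l, rfl, C, hC, f, hf⟩, hmax⟩ :=
    set_has_maximal_iff_noetherian.2 ‹IsNoetherianRing R› S hS
  by_cases hl : ∀ p ∉ V, ∃ x ∈ l, (x.2 : R) ∉ p.ideal
  · exact hf (h _ ⟨l, rfl, hl⟩ C f)
  push Not at hl
  obtain ⟨p, hp, hl⟩ := hl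
  have hD : IsCompactObject (koszulSeq (l.map φ.unitEnd) ⊗ C) :=
    prop_koszulSeq_tensor (compactObjects T) _ hC
  -- If `p ∉ V` contains the list, some `s ∉ p` kills `f`. Then `f⟦n⟧` factors through the cone of
  -- `s`, so the list enlarged by `s` still maps nontrivially to `X`, but it spans a strictly larger
  -- ideal.
  obtain ⟨n, s, hs, hfs⟩ := (φ.torsion_iff V X).1 hX _ hD p hp f
  obtain ⟨π, d, hT⟩ := koszul_triangle (φ.unitEnd ⟨n, s⟩) (koszulSeq (l.map φ.unitEnd) ⊗ C)
  obtain ⟨g, hg⟩ := dist_desc₂ hT (f⟦n⟧') ((φ.act_naturality f s).trans hfs)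
  refine hmax (Ideal.span { r | ∃ x ∈ (⟨n, s⟩ :: l : List (Σ n, 𝒜 n)), r = (x.2 : R) })
    ⟨_, rfl, C⟦-n⟧, hC.shift (-n), ?_⟩ ?_
  · by_contra! h₀
    have hg₀ : g = 0 := by
      refine hom_shift_eq_zero (fun k => ?_) g
      let i := (shiftFunctor T (-n)).mapIso
        (koszulSeqConsIso (φ.unitEnd ⟨n, s⟩) (l.map φ.unitEnd) C)
      have := h₀ ((tensorShiftIso _ _ _).hom ≫ i.hom ≫ k)
      rwa [Preadditive.IsIso.comp_left_eq_zero, Preadditive.IsIso.comp_left_eq_zero] at this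
    rw [hg₀, comp_zero] at hg
    exact hf ((shiftFunctor T n).map_injective (hg.trans (Functor.map_zero _ _ _).symm))
  · refine lt_of_le_of_ne (Ideal.span_mono ?_) fun he => hs ?_
    · rintro r ⟨x, hx, rfl⟩
      exact ⟨x, List.mem_cons_of_mem _ hx, rfl⟩
    · have h₁ : (s : R) ∈ Ideal.span { r | ∃ x ∈ l, r = (x.2 : R) } := by
        rw [he]
        exact Ideal.subset_span ⟨_, List.mem_cons_self, rfl⟩
      refine Ideal.span_le.2 ?_ h₁
      rintro r ⟨x, hx, rfl⟩
      exact hl x hx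

variable (hcomm : IsGradedCommutative 𝒜) (hgen : IsCompactlyGenerated T)
include hcomm hgen

/-- The torsion objects form the localising subcategory generated by the Koszul objects
supported on `V`; moreover there is a localisation functor with these as acyclic objects. -/
lemma exists_trW_koszul (V : Set (HomogeneousSpec 𝒜)) (S : ObjectProperty T) [IsLocalising S]
    (hS : ∀ L, φ.IsSupportedOn V L → ∀ W : T, S (koszulSeq L ⊗ W)) (X : T) :
    ∃ (Y : T) (c : X ⟶ Y), S.trW c ∧
      ∀ L, φ.IsSupportedOn V L → ∀ (W : T) (f : koszulSeq L ⊗ W ⟶ Y), f = 0 := by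
  obtain ⟨ι, G, hG, hG'⟩ := id hgen
  -- The index type must lie in `Type v`. Hence the lists consist of endomorphisms of `𝟙` rather
  -- than elements of `R`, and `W` runs over the generators only.
  obtain ⟨Y, c, hc, hY⟩ := exists_trW_orthogonal
    (fun j : { L // φ.IsSupportedOn V L } × ι => koszulSeq j.1.1 ⊗ G j.2)
    (fun j => prop_koszulSeq_tensor (compactObjects T) _ (hG j.2)) S (fun j => hS _ j.1.2 _) X
  refine ⟨Y, c, hc, fun L hL W f => ?_⟩
  -- The admissible `W` form a localising subcategory containing the generators.
  exact hG' ((shiftsOf Y).leftOrthogonal.inverseImage (tensorLeft (koszulSeq L))) inferInstance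
    (fun i => leftOrthogonal_shiftsOf fun n f => hY (⟨L, hL⟩, i) n f) W f (shiftsOf_self Y)

/-- A localising subcategory containing the Koszul objects supported on `V` contains all
`V`-torsion objects. -/
lemma torsion_le (V : Set (HomogeneousSpec 𝒜)) (S : ObjectProperty T) [IsLocalising S]
    (hS : ∀ L, φ.IsSupportedOn V L → ∀ W : T, S (koszulSeq L ⊗ W)) : φ.torsion V ≤ S := by
  intro X hX
  have := φ.isLocalising_torsion hcomm V
  -- Localise at the intersection with the torsion objects. The local term `Y` is then torsion and
  -- receives no morphisms from Koszul objects, hence is zero.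
  obtain ⟨Y, c, ⟨Z, g, h, hT, hZ⟩, hY⟩ := φ.exists_trW_koszul hcomm hgen V (S ⊓ φ.torsion V)
    (fun L hL W => ⟨hS L hL W, φ.torsion_koszulSeq hL W⟩) X
  have hY₀ : IsZero Y := φ.isZero_of_torsion hgen
    ((φ.torsion V).ext_of_isTriangulatedClosed₂ _ hT hX hZ.2) hY
  exact S.ext_of_isTriangulatedClosed₁ _ hT (S.prop_of_isZero hY₀) hZ.1

/-- Koszul objects generate the torsion objects, so orthogonality need only be tested on them. The
resulting condition is visibly stable under tensor products and coproducts. -/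
lemma localObjects_iff (V : Set (HomogeneousSpec 𝒜)) (Y : T) :
    φ.localObjects V Y ↔ ∀ L, φ.IsSupportedOn V L → IsZero (koszulSeq L ⊗ Y) := by
  refine ⟨fun h L hL => ?_, fun h X f hX => ?_⟩
  · rw [isZero_koszulSeq_tensor_iff]
    exact fun W f => h f (φ.torsion_koszulSeq hL W)
  · refine φ.torsion_le hcomm hgen V (shiftsOf Y).leftOrthogonal (fun L hL W => ?_) X hX f
      (shiftsOf_self Y)
    refine leftOrthogonal_shiftsOf fun n f => ?_
    rw [← cancel_epi (tensorShiftIso n (koszulSeq L) W).hom, comp_zero]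
    exact (isZero_koszulSeq_tensor_iff L Y).1 (h L hL) _ _

lemma exists_trW_localObjects (V : Set (HomogeneousSpec 𝒜)) (X : T) :
    ∃ (Y : T) (c : X ⟶ Y), (φ.torsion V).trW c ∧ φ.localObjects V Y := by
  have := φ.isLocalising_torsion hcomm V
  obtain ⟨Y, c, hc, hY⟩ := φ.exists_trW_koszul hcomm hgen V (φ.torsion V)
    (fun L hL W => φ.torsion_koszulSeq hL W) X
  exact ⟨Y, c, hc, (φ.localObjects_iff hcomm hgen V Y).2 fun L hL =>
    (isZero_koszulSeq_tensor_iff L Y).2 (hY L hL)⟩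

/-- By `torsion_le` it suffices to treat `K ⊗ W`, and `(K ⊗ W) ⊗ Y` is again of this form. -/
lemma isTensorIdeal_torsion (V : Set (HomogeneousSpec 𝒜)) : IsTensorIdeal (φ.torsion V) := by
  intro X Y hX
  have := φ.isLocalising_torsion hcomm V
  exact φ.torsion_le hcomm hgen V ((φ.torsion V).inverseImage (tensorRight Y))
    (fun L hL W => (φ.torsion V).prop_of_iso (α_ _ _ _).symm (φ.torsion_koszulSeq hL (W ⊗ Y))) X hX

lemma isTensorIdeal_localObjects (V : Set (HomogeneousSpec 𝒜)) :
    IsTensorIdeal (φ.localObjects V) := by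
  intro X Y hX
  rw [φ.localObjects_iff hcomm hgen] at hX ⊢
  exact fun L hL => (isZero_tensor_left Y (hX L hL)).of_iso (α_ _ _ _).symm

lemma isLocalising_localObjects (V : Set (HomogeneousSpec 𝒜)) :
    IsLocalising (φ.localObjects V) :=
  have : (φ.localObjects V).IsTriangulated :=
    inferInstanceAs (φ.torsion V).rightOrthogonal.IsTriangulated
  have : (φ.localObjects V).IsClosedUnderIsomorphisms :=
    inferInstanceAs (φ.torsion V).rightOrthogonal.IsClosedUnderIsomorphisms
  .of_coproduct fun J Y h => by
    simp only [φ.localObjects_iff hcomm hgen] at h ⊢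
    exact fun L hL => IsLocalising.coproduct
      (S := (zeroObjects T).inverseImage (tensorLeft (koszulSeq L))) fun j => h j L hL

end CanonicalAction

end KoszulTorsion

/-! ### Localisation triangles, the functors `Γ_p`, and supports -/

section Support

open Pretriangulated ZeroObject

variable {R : Type w} [Ring R] {𝒜 : ℤ → AddSubgroup R} [GradedRing 𝒜]
  {T : Type u} [Category.{v} T] [Preadditive T] [HasZeroObject T] [HasShift T ℤ]
  [∀ n : ℤ, (shiftFunctor T n).Additive] [Pretriangulated T] [IsTriangulated T]
  [HasCoproducts.{v} T] [MonoidalCategory T] [SymmetricCategory T]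
  [(curriedTensor T).CommShift₂Int] [IsTensorTriangulated T]

namespace CanonicalAction

variable (φ : CanonicalAction 𝒜 T) (V : Set (HomogeneousSpec 𝒜))

/-- A localisation triangle `A ⟶ X ⟶ Y ⟶ A⟦1⟧` with `A` torsion and `Y` local. -/
structure LocTriangle (A X Y : T) where
  /-- the first morphism -/
  a : A ⟶ X
  /-- the second morphism -/
  c : X ⟶ Y
  /-- the third morphism -/
  h : Y ⟶ A⟦(1 : ℤ)⟧
  mem : Triangle.mk a c h ∈ distTriang T
  torsion : φ.torsion V A
  isLocal : φ.localObjects V Y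

namespace LocTriangle

variable {φ V} {A X Y : T} (D : φ.LocTriangle V A X Y)

lemma hom_ext_torsion {W : T} (hW : φ.torsion V W) {l l' : W ⟶ A} (h : l ≫ D.a = l' ≫ D.a) :
    l = l' := by
  rw [← sub_eq_zero]
  obtain ⟨k, hk⟩ := dist_lift₁ D.mem ((l - l')⟦(1 : ℤ)⟧') (by
    rw [← Functor.map_comp, Preadditive.sub_comp, h, sub_self, Functor.map_zero])
  rw [D.isLocal k ((φ.torsion V).le_shift _ _ hW), zero_comp] at hk
  exact (shiftFunctor T (1 : ℤ)).map_injective (by rw [hk, Functor.map_zero])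

lemma hom_ext_local {W : T} (hW : φ.localObjects V W) {l l' : Y ⟶ W} (h : D.c ≫ l = D.c ≫ l') :
    l = l' := by
  rw [← sub_eq_zero]
  obtain ⟨k, hk⟩ := dist_desc₃ D.mem (l - l') (by rw [Preadditive.comp_sub, h, sub_self])
  rw [hk, hW k ((φ.torsion V).le_shift _ _ D.torsion), comp_zero]

/-- The torsion part of a localisation triangle is a coreflection. -/
noncomputable def isTerminal :
    IsTerminal (CostructuredArrow.mk (Y := (⟨A, D.torsion⟩ : (φ.torsion V).FullSubcategory))
      (S := (φ.torsion V).ι) D.a) :=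
  have ex (B : CostructuredArrow (φ.torsion V).ι X) : ∃ l : B.left.obj ⟶ A, B.hom = l ≫ D.a :=
    dist_lift₂ D.mem B.hom (D.isLocal _ B.left.property)
  IsTerminal.ofUniqueHom
    (fun B => CostructuredArrow.homMk (ObjectProperty.homMk (ex B).choose) (ex B).choose_spec.symm)
    fun B m => by
      refine CostructuredArrow.hom_ext _ _ (ObjectProperty.hom_ext _ ?_)
      have hm : m.left.hom ≫ D.a = B.hom := CostructuredArrow.w m
      exact D.hom_ext_torsion B.left.property (hm.trans (ex B).choose_spec)

/-- The local part of a localisation triangle is a reflection. -/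
noncomputable def isInitial :
    IsInitial (StructuredArrow.mk (Y := (⟨Y, D.isLocal⟩ : (φ.localObjects V).FullSubcategory))
      (T := (φ.localObjects V).ι) D.c) :=
  have ex (B : StructuredArrow X (φ.localObjects V).ι) : ∃ l : Y ⟶ B.right.obj, B.hom = D.c ≫ l :=
    dist_desc₂ D.mem B.hom (B.right.property _ D.torsion)
  IsInitial.ofUniqueHom
    (fun B => StructuredArrow.homMk (ObjectProperty.homMk (ex B).choose) (ex B).choose_spec.symm)
    fun B m => by
      refine StructuredArrow.hom_ext _ _ (ObjectProperty.hom_ext _ ?_)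
      have hm : D.c ≫ m.right.hom = B.hom := StructuredArrow.w m
      exact D.hom_ext_local B.right.property (hm.trans (ex B).choose_spec)

/-- Replacing the middle term of a localisation triangle by an isomorphic object. -/
def ofIso {X' : T} (e : X ≅ X') : φ.LocTriangle V A X' Y where
  a := D.a ≫ e.hom
  c := e.inv ≫ D.c
  h := D.h
  mem := by
    refine isomorphic_distinguished _ D.mem _
      (Triangle.isoMk _ _ (Iso.refl _) e.symm (Iso.refl _) ?_ ?_ ?_)
    · change (D.a ≫ e.hom) ≫ e.inv = 𝟙 _ ≫ D.a
      rw [Category.assoc, e.hom_inv_id, Category.comp_id, Category.id_comp]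
    · change (e.inv ≫ D.c) ≫ 𝟙 _ = e.inv ≫ D.c
      rw [Category.comp_id]
    · change D.h ≫ (𝟙 A)⟦(1 : ℤ)⟧' = 𝟙 _ ≫ D.h
      rw [CategoryTheory.Functor.map_id, Category.comp_id, Category.id_comp]
  torsion := D.torsion
  isLocal := D.isLocal

include D in
lemma localCohomology_iso (h : (φ.torsion V).ι.IsLeftAdjoint) :
    Nonempty ((φ.localCohomology V).obj X ≅ A) := by
  -- The existence of the adjoint rules out the default branch. Its value at `X` is terminal over
  -- `X`, as is `A`.
  have e : φ.localCohomology V = (φ.torsion V).ι.rightAdjoint ⋙ (φ.torsion V).ι := dif_pos h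
  rw [e]
  let i := (mkTerminalOfRightAdjoint _ (Adjunction.ofIsLeftAdjoint (φ.torsion V).ι) X).uniqueUpToIso
    D.isTerminal
  exact ⟨(φ.torsion V).ι.mapIso ((CostructuredArrow.proj _ _).mapIso i)⟩

include D in
lemma localisation_iso (h : (φ.localObjects V).ι.IsRightAdjoint) :
    Nonempty ((φ.localisation V).obj X ≅ Y) := by
  have e : φ.localisation V = (φ.localObjects V).ι.leftAdjoint ⋙ (φ.localObjects V).ι := dif_pos h
  rw [e]
  let i := (mkInitialOfLeftAdjoint _ (Adjunction.ofIsRightAdjoint (φ.localObjects V).ι) X).uniqueUpToIso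
    D.isInitial
  exact ⟨(φ.localObjects V).ι.mapIso ((StructuredArrow.proj _ _).mapIso i)⟩

end LocTriangle

variable {V} in
/-- The localisation triangle of a torsion object. -/
noncomputable def locTriangleOfTorsion {X : T} (hX : φ.torsion V X) : φ.LocTriangle V X X 0 where
  a := 𝟙 X
  c := 0
  h := 0
  mem := contractible_distinguished X
  torsion := hX
  isLocal _ _ _ := (isZero_zero T).eq_of_tgt _ _

variable {V} in
/-- The localisation triangle of a local object. -/
noncomputable def locTriangleOfLocal {X : T} (hX : φ.localObjects V X) :
    φ.LocTriangle V 0 X X where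
  a := 0
  c := 𝟙 X
  h := 0
  mem := contractible_distinguished₁ X
  torsion := (φ.torsion V).prop_of_isZero (isZero_zero T)
  isLocal := hX

variable [IsNoetherianRing R] (hcomm : IsGradedCommutative 𝒜) (hgen : IsCompactlyGenerated T)
include hcomm hgen

lemma exists_locTriangle (X : T) : ∃ A Y : T, Nonempty (φ.LocTriangle V A X Y) := by
  obtain ⟨Y, c, hc, hY⟩ := φ.exists_trW_localObjects hcomm hgen V X
  rw [ObjectProperty.trW_iff'] at hc
  obtain ⟨A, a, h, hT, hA⟩ := hc
  exact ⟨A, Y, ⟨⟨a, c, h, hT, hA, hY⟩⟩⟩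

/-- The inclusion of the torsion objects has a right adjoint. -/
theorem isLeftAdjoint_torsion_ι : (φ.torsion V).ι.IsLeftAdjoint := by
  rw [isLeftAdjoint_iff_hasTerminal_costructuredArrow]
  intro X
  obtain ⟨A, Y, ⟨D⟩⟩ := φ.exists_locTriangle V hcomm hgen X
  exact D.isTerminal.hasTerminal

/-- The inclusion of the local objects has a left adjoint. -/
theorem isRightAdjoint_localObjects_ι : (φ.localObjects V).ι.IsRightAdjoint := by
  rw [isRightAdjoint_iff_hasInitial_structuredArrow]
  intro X
  obtain ⟨A, Y, ⟨D⟩⟩ := φ.exists_locTriangle V hcomm hgen X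
  exact D.isInitial.hasInitial

/-- Tensoring a localisation triangle with an object. -/
lemma LocTriangle.tensor {V : Set (HomogeneousSpec 𝒜)} {A X Y : T}
    (D : φ.LocTriangle V A X Y) (Z : T) :
    Nonempty (φ.LocTriangle V (A ⊗ Z) (X ⊗ Z) (Y ⊗ Z)) := by
  have := IsTensorTriangulated.exact_tensorRight Z
  exact ⟨_, _, _, (tensorRight Z).map_distinguished _ D.mem,
    φ.isTensorIdeal_torsion hcomm hgen V _ Z D.torsion,
    φ.isTensorIdeal_localObjects hcomm hgen V _ Z D.isLocal⟩

/-- `Γ_p` is given by tensoring with an object. -/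
lemma exists_localCohomologyAt_iso (p : HomogeneousSpec 𝒜) :
    ∃ A B : T, φ.torsion (closureOf p) A ∧ φ.localObjects (awayFrom p) B ∧
      ∀ X : T, Nonempty ((φ.localCohomologyAt p).obj X ≅ (A ⊗ B) ⊗ X) := by
  obtain ⟨A, B', ⟨D⟩⟩ := φ.exists_locTriangle (closureOf p) hcomm hgen (𝟙_ T)
  obtain ⟨A', B, ⟨D'⟩⟩ := φ.exists_locTriangle (awayFrom p) hcomm hgen (𝟙_ T)
  refine ⟨A, B, D.torsion, D'.isLocal, fun X => ?_⟩
  -- Triangles of the unit, tensored with an object, compute `L` and `Γ` at that object.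
  obtain ⟨E'⟩ := D'.tensor φ hcomm hgen X
  obtain ⟨i⟩ := (E'.ofIso (λ_ X)).localisation_iso
    (φ.isRightAdjoint_localObjects_ι (awayFrom p) hcomm hgen)
  obtain ⟨E⟩ := D.tensor φ hcomm hgen ((φ.localisation (awayFrom p)).obj X)
  obtain ⟨j⟩ := (E.ofIso (λ_ _)).localCohomology_iso
    (φ.isLeftAdjoint_torsion_ι (closureOf p) hcomm hgen)
  exact ⟨j ≪≫ whiskerLeftIso A i ≪≫ (α_ _ _ _).symm⟩

/-- The essential image of `Γ_p` consists of the torsion local objects. -/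
lemma essImage_localCohomologyAt (p : HomogeneousSpec 𝒜) :
    (φ.localCohomologyAt p).essImage =
      φ.torsion (closureOf p) ⊓ φ.localObjects (awayFrom p) := by
  have := φ.isLocalising_torsion hcomm (closureOf p)
  have := φ.isLocalising_localObjects hcomm hgen (awayFrom p)
  ext Z
  constructor
  · rintro ⟨X, ⟨i⟩⟩
    obtain ⟨A, B, hA, hB, h⟩ := φ.exists_localCohomologyAt_iso hcomm hgen p
    obtain ⟨j⟩ := h X
    refine ⟨(φ.torsion (closureOf p)).prop_of_iso (j.symm ≪≫ i)
      (φ.isTensorIdeal_torsion hcomm hgen _ _ _ (φ.isTensorIdeal_torsion hcomm hgen _ _ _ hA)),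
      -- The braiding brings the local factor `B` to the front, where `IsTensorIdeal` applies.
      (φ.localObjects (awayFrom p)).prop_of_iso (whiskerRightIso (β_ B A) X ≪≫ j.symm ≪≫ i)
      (φ.isTensorIdeal_localObjects hcomm hgen _ _ _
        (φ.isTensorIdeal_localObjects hcomm hgen _ _ _ hB))⟩
  · rintro ⟨h₁, h₂⟩
    -- Conversely, `L` fixes the local object `Z` and `Γ` fixes it because it is torsion, so `Z ≅
    -- Γ_p Z`.
    obtain ⟨i⟩ := (φ.locTriangleOfLocal h₂).localisation_iso
      (φ.isRightAdjoint_localObjects_ι _ hcomm hgen)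
    obtain ⟨j⟩ := (φ.locTriangleOfTorsion h₁).localCohomology_iso
      (φ.isLeftAdjoint_torsion_ι _ hcomm hgen)
    exact ⟨Z, ⟨(φ.localCohomology (closureOf p)).mapIso i ≪≫ j⟩⟩

/-- The tensor product theorem for the support in a stratified category. -/
theorem supp_tensor (hstrat : φ.IsStratified) (X Y : T) :
    φ.supp (X ⊗ Y) = φ.supp X ∩ φ.supp Y := by
  ext p
  obtain ⟨A, B, -, -, hG⟩ := φ.exists_localCohomologyAt_iso hcomm hgen p
  have hzero : ∀ Z, IsZero ((φ.localCohomologyAt p).obj Z) ↔ IsZero ((A ⊗ B) ⊗ Z) :=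
    fun Z => (hG Z).some.isZero_iff
  change ¬ IsZero _ ↔ ¬ IsZero _ ∧ ¬ IsZero _
  simp only [hzero]
  refine ⟨fun h => ⟨fun hX => h ?_, fun hY => h ?_⟩, fun ⟨hX, hY⟩ h => hY ?_⟩
  · exact (isZero_tensor_left Y hX).of_iso (α_ _ _ _).symm
  · exact (isZero_tensor_right X hY).of_iso (tensorSwapIso _ _ _)
  -- The part of `Γ_p T` annihilated by `Y`; it contains the nonzero object `Γ_p X`, so minimality
  -- applies.
  · let S : ObjectProperty T := (φ.torsion (closureOf p) ⊓ φ.localObjects (awayFrom p)) ⊓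
      (zeroObjects T).inverseImage (tensorRight Y)
    have hess := φ.essImage_localCohomologyAt hcomm hgen p
    have hmem : ∀ Z, (φ.localCohomologyAt p).essImage ((A ⊗ B) ⊗ Z) := fun Z => ⟨Z, hG Z⟩
    have := φ.isLocalising_torsion hcomm (closureOf p)
    have := φ.isLocalising_localObjects hcomm hgen (awayFrom p)
    have hS : S = (φ.localCohomologyAt p).essImage := by
      refine hstrat p ⟨_, hmem X, hX⟩ S inferInstance ?_ (hess ▸ inf_le_left)
        ⟨(A ⊗ B) ⊗ X, ⟨hess ▸ hmem X, h.of_iso (α_ _ _ _)⟩, hX⟩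
      rintro Z W ⟨⟨h₁, h₂⟩, h₃⟩
      refine ⟨⟨φ.isTensorIdeal_torsion hcomm hgen _ _ _ h₁,
        φ.isTensorIdeal_localObjects hcomm hgen _ _ _ h₂⟩, ?_⟩
      exact (isZero_tensor_left W h₃).of_iso (α_ Z W Y ≪≫ whiskerLeftIso Z (β_ W Y) ≪≫
        (α_ Z Y W).symm)
    -- Evaluate at `Γ_p 𝟙 ≅ A ⊗ B`: it is annihilated by `Y`, which says `Γ_p Y = 0`.
    have h₁ : S ((A ⊗ B) ⊗ 𝟙_ T) := hS ▸ hmem _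
    exact IsZero.of_iso h₁.2 (whiskerRightIso (ρ_ (A ⊗ B)) Y).symm

end CanonicalAction

end Support

end TensorSupport

theorem mainTheorem10
    {R : Type w} [Ring R] (𝒜 : ℤ → AddSubgroup R) [GradedRing 𝒜]
    (hcomm : TensorSupport.IsGradedCommutative 𝒜) [IsNoetherianRing R]
    {T : Type u} [Category.{v} T] [Preadditive T] [HasZeroObject T] [HasShift T ℤ]
    [∀ n : ℤ, (shiftFunctor T n).Additive] [Pretriangulated T] [IsTriangulated T]
    [HasCoproducts.{v} T] [MonoidalCategory T] [SymmetricCategory T]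
    [(curriedTensor T).CommShift₂Int] [TensorSupport.IsTensorTriangulated T]
    (hgen : TensorSupport.IsCompactlyGenerated T)
    (φ : TensorSupport.CanonicalAction 𝒜 T) (hstrat : φ.IsStratified) :
    (∀ V : Set (TensorSupport.HomogeneousSpec 𝒜), TensorSupport.IsSpecialisationClosed V →
      (φ.torsion V).ι.IsLeftAdjoint ∧ (φ.localObjects V).ι.IsRightAdjoint) ∧
    ∀ X Y : T, φ.supp (X ⊗ Y) = φ.supp X ∩ φ.supp Y := by
  exact ⟨fun V _ => ⟨φ.isLeftAdjoint_torsion_ι V hcomm hgen,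
    φ.isRightAdjoint_localObjects_ι V hcomm hgen⟩, φ.supp_tensor hcomm hgen hstrat⟩
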